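/- Let $M$ be a smooth $n$-dimensional manifold (Hausdorff, second countable) and let $\Theta$ be a smooth symmetric $(2,0)$ tensor field on $M$ of constant rank, that is, a smooth family of symmetric bilinear forms on the cotangent spaces $T_x^*M$ such that the corresponding linear maps $\Theta_x:T_x^*M\to T_xM$, $\xi\mapsto\Theta_x(\xi,\cdot)$, all have the same rank. Then there exists a smooth torsion-free connection $\nabla$ on $TM$ with $\nabla\Theta=0$ if and only if the image distribution $\mathrm{Im}\,\Theta\subseteq TM$, with the fibres $\Theta_x(T_x^*M)\subseteq T_xM$, is integrable, that is, through every point of $M$ there passes an (immersed) submanifold whose tangent space at each of its points $y$ is $\Theta_y(T_y^*M)$. -/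

import Mathlib

open Bundle
open scoped Manifold ContDiff

namespace SymTensor

noncomputable section

section

/-- A (not necessarily smooth) `1`-form on the `n`-dimensional manifold `M`. -/
abbrev OneForm (n : ℕ) (M : Type*) [TopologicalSpace M]
    [ChartedSpace (EuclideanSpace ℝ (Fin n)) M] : Type _ :=
  Π x : M, TangentSpace (𝓡 n) x →L[ℝ] ℝ

/-- A (not necessarily smooth) `(2,0)` tensor field on `M`, treated as a family of linear maps
`T*ₓM → TₓM`; the corresponding bilinear form on `T*ₓM` is `(ξ, η) ↦ η (Θ x ξ)`. -/
abbrev Tensor20 (n : ℕ) (M : Type*) [TopologicalSpace M]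
    [ChartedSpace (EuclideanSpace ℝ (Fin n)) M] : Type _ :=
  Π x : M, (TangentSpace (𝓡 n) x →L[ℝ] ℝ) →L[ℝ] TangentSpace (𝓡 n) x

/-- A connection in the tangent bundle of `M` (with no smoothness imposed). In Mathlib's convention
`cov Y x v` is the covariant derivative at `x` of the vector field `Y` in the direction `v`. -/
abbrev Connection (n : ℕ) (M : Type*) [TopologicalSpace M]
    [ChartedSpace (EuclideanSpace ℝ (Fin n)) M] [IsManifold (𝓡 n) ∞ M] : Type _ :=
  CovariantDerivative (𝓡 n) (EuclideanSpace ℝ (Fin n)) (TangentSpace (𝓡 n) : M → Type _)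

variable {n : ℕ} {M : Type*} [TopologicalSpace M] [ChartedSpace (EuclideanSpace ℝ (Fin n)) M]

/-- Symmetry: `Θ(ξ, η) = Θ(η, ξ)`. -/
def Tensor20.IsSymmetric (Θ : Tensor20 n M) : Prop :=
  ∀ (x : M) (ξ η : TangentSpace (𝓡 n) x →L[ℝ] ℝ), η (Θ x ξ) = ξ (Θ x η)

/-- The image distribution `Im Θ`, with the fibre `{Θ x ξ | ξ ∈ T*ₓM}` at `x`. -/
def Tensor20.image (Θ : Tensor20 n M) (x : M) : Submodule ℝ (TangentSpace (𝓡 n) x) :=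
  LinearMap.range (Θ x : (TangentSpace (𝓡 n) x →L[ℝ] ℝ) →ₗ[ℝ] TangentSpace (𝓡 n) x)

/-- Constant rank: all the maps `Θ x : T*ₓM → TₓM` have the same rank. -/
def Tensor20.HasConstantRank (Θ : Tensor20 n M) : Prop :=
  ∃ r : ℕ, ∀ x : M, Module.finrank ℝ (Θ.image x) = r

/-- A distribution `D` on `M` is integrable if every point of `M` lies on an integral manifold
of `D`: a submanifold, given here by an injective smooth parametrization `f : U → M` with an open
domain `U` in some `ℝᵏ`, which is an immersion and has the tangent space `D (f u)` at each point
`f u`. -/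
def IsIntegrableDistribution (D : Π x : M, Submodule ℝ (TangentSpace (𝓡 n) x)) : Prop :=
  ∀ p : M, ∃ (k : ℕ) (U : Set (EuclideanSpace ℝ (Fin k))) (f : EuclideanSpace ℝ (Fin k) → M),
    IsOpen U ∧ ContMDiffOn (𝓡 k) (𝓡 n) ∞ f U ∧ Set.InjOn f U ∧ p ∈ f '' U ∧
    ∀ u ∈ U, Function.Injective (mfderiv (𝓡 k) (𝓡 n) f u) ∧
      LinearMap.range (mfderiv (𝓡 k) (𝓡 n) f u :
        TangentSpace (𝓡 k) u →ₗ[ℝ] TangentSpace (𝓡 n) (f u)) = D (f u)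

variable [IsManifold (𝓡 n) ∞ M]

/-- Differentiability at `x` of a `1`-form, as a section of the cotangent bundle. -/
def OneForm.DifferentiableAt (α : OneForm n M) (x : M) : Prop :=
  MDifferentiableAt (𝓡 n) ((𝓡 n).prod 𝓘(ℝ, EuclideanSpace ℝ (Fin n) →L[ℝ] ℝ))
    (fun y ↦ TotalSpace.mk' (EuclideanSpace ℝ (Fin n) →L[ℝ] ℝ)
      (E := fun z : M ↦ (TangentSpace (𝓡 n) z →L[ℝ] ℝ)) y (α y)) x

/-- Smoothness of a `(2,0)` tensor field, as a section of the bundle `Hom(T*M, TM)`. -/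
def Tensor20.IsSmooth (Θ : Tensor20 n M) : Prop :=
  ContMDiff (𝓡 n) ((𝓡 n).prod 𝓘(ℝ, (EuclideanSpace ℝ (Fin n) →L[ℝ] ℝ) →L[ℝ]
      EuclideanSpace ℝ (Fin n))) ∞
    (fun y ↦ TotalSpace.mk' ((EuclideanSpace ℝ (Fin n) →L[ℝ] ℝ) →L[ℝ] EuclideanSpace ℝ (Fin n))
      (E := fun z : M ↦ ((TangentSpace (𝓡 n) z →L[ℝ] ℝ) →L[ℝ] TangentSpace (𝓡 n) z)) y (Θ y))

/-- `Y ↦ d_v(α(Y)) - α(∇_v Y)` for a tangent vector `v` at `x`, which is the covariant derivative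
`∇_v α` of the `1`-form `α` evaluated on the vector field `Y`. -/
def dualDerivAux (cov : Connection n M) (α : OneForm n M) (x : M) (v : TangentSpace (𝓡 n) x)
    (Y : Π y : M, TangentSpace (𝓡 n) y) : ℝ :=
  mvfderiv (𝓡 n) (fun y ↦ α y (Y y)) x v - α x (cov Y x v)

theorem OneForm.DifferentiableAt.apply {α : OneForm n M} {x : M} (hα : α.DifferentiableAt x)
    {Y : Π y : M, TangentSpace (𝓡 n) y}
    (hY : MDifferentiableAt (𝓡 n) ((𝓡 n).prod 𝓘(ℝ, EuclideanSpace ℝ (Fin n)))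
      (fun y ↦ TotalSpace.mk' (EuclideanSpace ℝ (Fin n)) y (Y y)) x) :
    MDifferentiableAt (𝓡 n) 𝓘(ℝ, ℝ) (fun y ↦ α y (Y y)) x := by
  have h : MDifferentiableAt (𝓡 n) ((𝓡 n).prod 𝓘(ℝ, ℝ))
      (fun y ↦ TotalSpace.mk' ℝ (E := Bundle.Trivial M ℝ) y (α y (Y y))) x :=
    MDifferentiableAt.clm_bundle_apply (E₂ := Bundle.Trivial M ℝ) hα hY
  rw [mdifferentiableAt_totalSpace] at h
  simpa using h.2

theorem tensorialAt_dualDerivAux (cov : Connection n M) {α : OneForm n M} {x : M}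
    (hα : α.DifferentiableAt x) (v : TangentSpace (𝓡 n) x) :
    TensorialAt (𝓡 n) (EuclideanSpace ℝ (Fin n)) (dualDerivAux cov α x v) x where
  smul hf hY := by
    simp [dualDerivAux, mvfderiv_fun_mul hf (hα.apply hY),
      cov.isCovariantDerivativeOn.leibniz hY hf]
    ring
  add hY hY' := by
    simp [dualDerivAux, mvfderiv_fun_add (hα.apply hY) (hα.apply hY'),
      cov.isCovariantDerivativeOn.add hY hY']
    abel

/-- The covariant derivative `∇_v α` at `x` of a `1`-form `α` differentiable at `x`, with respect
to the dual connection: `(∇_v α)(Y) = d_v(α(Y)) - α(∇_v Y)`. -/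
def dualDeriv (cov : Connection n M) {α : OneForm n M} {x : M} (hα : α.DifferentiableAt x)
    (v : TangentSpace (𝓡 n) x) : TangentSpace (𝓡 n) x →L[ℝ] ℝ :=
  TensorialAt.mkHom (dualDerivAux cov α x v) x (tensorialAt_dualDerivAux cov hα v)

theorem dualDeriv_apply (cov : Connection n M) {α : OneForm n M} {x : M}
    (hα : α.DifferentiableAt x) {Y : Π y : M, TangentSpace (𝓡 n) y}
    (hY : MDifferentiableAt (𝓡 n) ((𝓡 n).prod 𝓘(ℝ, EuclideanSpace ℝ (Fin n)))
      (fun y ↦ TotalSpace.mk' (EuclideanSpace ℝ (Fin n)) y (Y y)) x)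
    (v : TangentSpace (𝓡 n) x) :
    dualDeriv cov hα v (Y x) =
      mvfderiv (𝓡 n) (fun y ↦ α y (Y y)) x v - α x (cov Y x v) :=
  TensorialAt.mkHom_apply (tensorialAt_dualDerivAux cov hα v) hY

/-- `∇Θ = 0`, that is, `(∇_v Θ)ξ = ∇_v(Θξ) - Θ(∇_v ξ)` vanishes for all vectors `v` and all
`1`-forms `ξ`. -/
def Tensor20.IsParallel (Θ : Tensor20 n M) (cov : Connection n M) : Prop :=
  ∀ (x : M) (ξ : OneForm n M) (hξ : ξ.DifferentiableAt x) (v : TangentSpace (𝓡 n) x),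
    cov (fun y ↦ Θ y (ξ y)) x v = Θ x (dualDeriv cov hξ v)

/-- Integrability of a `(2,0)` tensor: some smooth torsion-free connection makes it parallel. -/
def Tensor20.IsIntegrable (Θ : Tensor20 n M) : Prop :=
  ∃ cov : Connection n M,
    CovariantDerivative.ContMDiffCovariantDerivative cov ∞ ∧ cov.torsion = 0 ∧ Θ.IsParallel cov

end

end

end SymTensor

/-!
Near each point choose a smooth generalized inverse `G` of `Θ` in a chart, so that `P = Θ G` is a
projection onto the image of `Θ`. The image is involutive exactly when the derivative of `Θ` in the
direction `Θ ξ`, applied to `η`, is symmetric in `ξ` and `η` modulo the image.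

If `Θ` is parallel for a torsion-free connection, the bracket of two fields `Θ α` and `Θ β` is
tangent to the image, and the Frobenius theorem for the total differential equation
`f' = P(f) ∘ L` produces the integral manifolds. Conversely, involutivity makes an explicit
algebraic expression in `Θ`, `G` and the derivative of `Θ` a family of symmetric Christoffel symbols
for which `Θ` is parallel. Torsion-free connections with `∇Θ = 0` are closed under averaging with a
partition of unity, so the local ones glue to a global one.
-/

namespace SymTensor

noncomputable section

set_option maxSynthPendingDepth 3

section TotalDifferentialEquation

open Set Metric Topology Asymptotics
open scoped NNReal

variable {V E F : Type*} [NormedAddCommGroup V] [NormedSpace ℝ V]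
  [NormedAddCommGroup E] [NormedSpace ℝ E] [NormedAddCommGroup F] [NormedSpace ℝ F]

/-- On `s` the function `A` is differentiable with `C^{1,1}`-norm at most `C`. -/
structure IsC11BoundedOn (A : E → F) (C : ℝ) (s : Set E) : Prop where
  differentiableAt : ∀ x ∈ s, DifferentiableAt ℝ A x
  norm_le : ∀ x ∈ s, ‖A x‖ ≤ C
  norm_fderiv_le : ∀ x ∈ s, ‖fderiv ℝ A x‖ ≤ C
  norm_fderiv_sub_le : ∀ x ∈ s, ∀ y ∈ s, ‖fderiv ℝ A y - fderiv ℝ A x‖ ≤ C * ‖y - x‖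

namespace IsC11BoundedOn

variable {A : E → F} {C : ℝ} {s : Set E} {x y : E}

theorem norm_sub_le (hA : IsC11BoundedOn A C s) (hs : Convex ℝ s) (hx : x ∈ s) (hy : y ∈ s) :
    ‖A y - A x‖ ≤ C * ‖y - x‖ :=
  hs.norm_image_sub_le_of_norm_fderiv_le (𝕜 := ℝ) hA.differentiableAt hA.norm_fderiv_le hx hy

theorem norm_sub_sub_fderiv_le (hA : IsC11BoundedOn A C s) (hC : 0 ≤ C) (hs : Convex ℝ s)
    (hx : x ∈ s) (hy : y ∈ s) :
    ‖A y - A x - fderiv ℝ A x (y - x)‖ ≤ C * ‖y - x‖ ^ 2 := by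
  have hseg : segment ℝ x y ⊆ s := hs.segment_subset hx hy
  rw [sq, ← mul_assoc]
  refine (convex_segment x y).norm_image_sub_le_of_norm_hasFDerivWithin_le' (𝕜 := ℝ)
    (fun z hz ↦ (hA.differentiableAt z (hseg hz)).hasFDerivAt.hasFDerivWithinAt)
    (fun z hz ↦ (hA.norm_fderiv_sub_le x hx z (hseg hz)).trans ?_)
    (left_mem_segment ℝ x y) (right_mem_segment ℝ x y)
  gcongr
  exact norm_sub_le_of_mem_segment hz

end IsC11BoundedOn

theorem exists_isC11BoundedOn_closedBall {A : E → F} {x₀ : E} {s : Set E} (hs : s ∈ 𝓝 x₀)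
    (hA : ContDiffAt ℝ 2 A x₀) :
    ∃ R > 0, ∃ C > 0, closedBall x₀ R ⊆ s ∧ IsC11BoundedOn A C (closedBall x₀ R) := by
  have hA' : ContDiffAt ℝ 1 (fderiv ℝ A) x₀ := hA.fderiv_right (by norm_num)
  obtain ⟨K, t, ht, hK⟩ := hA'.exists_lipschitzOnWith
  obtain ⟨C, hC⟩ := exists_gt (max (max ‖A x₀‖ ‖fderiv ℝ A x₀‖) K)
  simp only [max_lt_iff] at hC
  obtain ⟨⟨hC₀, hC₁⟩, hKC⟩ := hC
  have hdiff : ∀ᶠ x in 𝓝 x₀, DifferentiableAt ℝ A x := by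
    filter_upwards [hA.eventually (by simp)] with x hx using hx.differentiableAt (by simp)
  have hnorm : ∀ᶠ x in 𝓝 x₀, ‖A x‖ < C := hA.continuousAt.norm.eventually_lt_const hC₀
  have hnorm' : ∀ᶠ x in 𝓝 x₀, ‖fderiv ℝ A x‖ < C := hA'.continuousAt.norm.eventually_lt_const hC₁
  obtain ⟨R, hR, hball⟩ := nhds_basis_closedBall.mem_iff.1
    (Filter.inter_mem hs (Filter.inter_mem ht (hdiff.and (hnorm.and hnorm'))))
  refine ⟨R, hR, C, (norm_nonneg _).trans_lt hC₀, fun x hx ↦ (hball hx).1, ?_⟩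
  exact
    { differentiableAt := fun x hx ↦ (hball hx).2.2.1
      norm_le := fun x hx ↦ (hball hx).2.2.2.1.le
      norm_fderiv_le := fun x hx ↦ (hball hx).2.2.2.2.le
      norm_fderiv_sub_le := fun x hx y hy ↦ by
        have := hK.norm_sub_le (hball hy).2.1 (hball hx).2.1
        exact this.trans (by gcongr) }

theorem norm_le_exp_mul_of_norm_deriv_le {f f' : ℝ → E} {K ε t : ℝ} (hK : 0 ≤ K) (hε : 0 ≤ ε)
    (hf : ∀ t ∈ Icc (0 : ℝ) 1, HasDerivWithinAt f (f' t) (Icc 0 1) t) (hf0 : f 0 = 0)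
    (hf' : ∀ t ∈ Icc (0 : ℝ) 1, ‖f' t‖ ≤ K * ‖f t‖ + ε) (ht : t ∈ Icc (0 : ℝ) 1) :
    ‖f t‖ ≤ Real.exp K * ε := by
  have h := norm_le_gronwallBound_of_norm_deriv_right_le (f := f) (f' := f') (δ := 0) (K := K)
    (ε := ε) (a := 0) (b := 1) (fun t ht ↦ (hf t ht).continuousWithinAt)
    (fun x hx ↦ (hf x (Ico_subset_Icc_self hx)).mono_of_mem_nhdsWithin
      (Icc_mem_nhdsGE_of_mem hx)) (by simp [hf0])
    (fun x hx ↦ hf' x (Ico_subset_Icc_self hx)) t ht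
  have hone : gronwallBound 0 K ε 1 ≤ Real.exp K * ε := by
    rcases hK.eq_or_lt with rfl | hK
    · simp [gronwallBound_K0]
    · rw [gronwallBound_of_K_ne_0 hK.ne']
      have hexp : Real.exp K - 1 ≤ K * Real.exp K := by
        have := mul_le_mul_of_nonneg_left (Real.one_sub_le_exp_neg K) (Real.exp_pos K).le
        rw [← Real.exp_add, add_neg_cancel, Real.exp_zero] at this
        linarith
      calc 0 * Real.exp (K * 1) + ε / K * (Real.exp (K * 1) - 1)
          = ε / K * (Real.exp K - 1) := by simp
        _ ≤ ε / K * (K * Real.exp K) := by gcongr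
        _ = Real.exp K * ε := by field_simp
  exact (h.trans (gronwallBound_mono le_rfl hε hK (by simpa using ht.2))).trans hone

/-- `γ` is, on `[0, 1]`, the restriction to the ray `t ↦ t • w` of a would-be solution in `s` of
the total differential equation `f' = A ∘ f`, `f 0 = x₀`. -/
structure IsRadialSolution (A : E → V →L[ℝ] E) (x₀ : E) (s : Set E) (w : V) (γ : ℝ → E) :
    Prop where
  apply_zero : γ 0 = x₀
  mem : ∀ t ∈ Icc (0 : ℝ) 1, γ t ∈ s
  hasDerivWithinAt : ∀ t ∈ Icc (0 : ℝ) 1, HasDerivWithinAt γ (A (γ t) w) (Icc 0 1) t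

theorem IsC11BoundedOn.exists_isRadialSolution [CompleteSpace E] {A : E → V →L[ℝ] E} {x₀ : E}
    {R C : ℝ} (hA : IsC11BoundedOn A C (closedBall x₀ R)) (hC : 0 ≤ C) {w : V}
    (hw : C * ‖w‖ ≤ R) : ∃ γ, IsRadialSolution A x₀ (closedBall x₀ R) w γ := by
  lift C to ℝ≥0 using hC
  lift R to ℝ≥0 using (by positivity : 0 ≤ C * ‖w‖).trans hw
  have hlip : LipschitzOnWith (C * ‖w‖₊) (fun x ↦ A x w) (closedBall x₀ R) := by
    refine LipschitzOnWith.of_dist_le_mul fun x hx y hy ↦ ?_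
    rw [dist_eq_norm, dist_eq_norm, ← sub_apply]
    calc ‖(A x - A y) w‖ ≤ ‖A x - A y‖ * ‖w‖ := (A x - A y).le_opNorm w
      _ ≤ C * ‖x - y‖ * ‖w‖ := by gcongr; exact hA.norm_sub_le (convex_closedBall _ _) hy hx
      _ = _ := by push_cast; ring
  have hnorm : ∀ x ∈ closedBall x₀ (R : ℝ), ‖A x w‖ ≤ R := fun x hx ↦
    ((A x).le_of_opNorm_le (hA.norm_le x hx) w).trans hw
  have hpicard : IsPicardLindelof (fun _ x ↦ A x w) (tmin := 0) (tmax := 1) ⟨0, by simp⟩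
      x₀ R 0 R (C * ‖w‖₊) :=
    { lipschitzOnWith := fun _ _ ↦ hlip
      continuousOn := fun _ _ ↦ continuousOn_const
      norm_le := fun _ _ ↦ hnorm
      mul_max_le := by simp }
  obtain ⟨α, hα⟩ := ODE.FunSpace.exists_isFixedPt_next hpicard (mem_closedBall_self le_rfl)
  have hpic : ∀ t ∈ Icc (0 : ℝ) 1,
      α.compProj t = ODE.picard (fun _ x ↦ A x w) 0 x₀ α.compProj t := fun t ht ↦ by
    rw [ODE.FunSpace.compProj_of_mem ht]
    nth_rw 1 [← hα]
    rw [ODE.FunSpace.next_apply]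
  refine ⟨α.compProj, ?_, fun t _ ↦ α.compProj_mem_closedBall hpicard.mul_max_le, fun t ht ↦ ?_⟩
  · rw [hpic 0 (by simp), ODE.picard_apply₀]
  · exact (ODE.hasDerivWithinAt_picard_Icc (t₀ := 0) (by simp) hpicard.continuousOn_uncurry
      α.continuous_compProj.continuousOn
      (fun _ _ ↦ α.compProj_mem_closedBall hpicard.mul_max_le) x₀ ht).congr_of_mem hpic ht

namespace IsRadialSolution

variable {A : E → V →L[ℝ] E} {x₀ : E} {s : Set E} {w w' : V} {γ γ' : ℝ → E} {C R t : ℝ}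

theorem apply_one_of_zero (hγ : IsRadialSolution A x₀ s 0 γ) : γ 1 = x₀ := by
  have := norm_le_exp_mul_of_norm_deriv_le (f := fun t ↦ γ t - x₀) zero_le_one le_rfl
    (fun t ht ↦ (hγ.hasDerivWithinAt t ht).sub_const x₀) (by simp [hγ.apply_zero])
    (fun _ _ ↦ by simp) (right_mem_Icc.2 zero_le_one)
  simpa [sub_eq_zero] using this

theorem norm_sub_le (hγ : IsRadialSolution A x₀ s w γ) (hγ' : IsRadialSolution A x₀ s w' γ')
    (hA : IsC11BoundedOn A C s) (hs : Convex ℝ s) (hC : 0 ≤ C) (hw' : C * ‖w'‖ ≤ R)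
    (ht : t ∈ Icc (0 : ℝ) 1) : ‖γ' t - γ t‖ ≤ Real.exp R * (C * ‖w' - w‖) := by
  refine norm_le_exp_mul_of_norm_deriv_le ((by positivity : 0 ≤ C * ‖w'‖).trans hw')
    (by positivity) (fun t ht ↦ (hγ'.hasDerivWithinAt t ht).sub (hγ.hasDerivWithinAt t ht))
    (by simp [hγ.apply_zero, hγ'.apply_zero]) (fun t ht ↦ ?_) ht
  have hmem := hγ.mem t ht
  calc ‖A (γ' t) w' - A (γ t) w‖
      = ‖(A (γ' t) - A (γ t)) w' + A (γ t) (w' - w)‖ := by simp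
    _ ≤ ‖(A (γ' t) - A (γ t)) w'‖ + ‖A (γ t) (w' - w)‖ := norm_add_le _ _
    _ ≤ C * ‖γ' t - γ t‖ * ‖w'‖ + C * ‖w' - w‖ :=
        add_le_add
          (ContinuousLinearMap.le_of_opNorm_le _ (hA.norm_sub_le hs hmem (hγ'.mem t ht)) _)
          (ContinuousLinearMap.le_of_opNorm_le _ (hA.norm_le _ hmem) _)
    _ = C * ‖w'‖ * ‖γ' t - γ t‖ + C * ‖w' - w‖ := by ring
    _ ≤ R * ‖γ' t - γ t‖ + C * ‖w' - w‖ := by gcongr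

-- The integrability condition makes `t • A (γ t) v` a solution of the equation of first variation.
theorem hasDerivWithinAt_smul_apply (hγ : IsRadialSolution A x₀ s w γ)
    (hA : ∀ x ∈ s, DifferentiableAt ℝ A x)
    (hsymm : ∀ x ∈ s, ∀ v w, fderiv ℝ A x (A x v) w = fderiv ℝ A x (A x w) v) (v : V)
    (ht : t ∈ Icc (0 : ℝ) 1) :
    HasDerivWithinAt (fun t ↦ t • A (γ t) v)
      (fderiv ℝ A (γ t) (t • A (γ t) v) w + A (γ t) v) (Icc 0 1) t := by
  have hmem := hγ.mem t ht
  have h := (hasDerivWithinAt_id t (Icc 0 1)).smul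
    (((hA _ hmem).hasFDerivAt.comp_hasDerivWithinAt t
      (hγ.hasDerivWithinAt t ht)).clm_apply (hasDerivWithinAt_const t _ v))
  refine h.congr_deriv ?_
  simp [hsymm _ hmem w v]

theorem norm_sub_sub_le (hγ : IsRadialSolution A x₀ s w γ) (hγ' : IsRadialSolution A x₀ s w' γ')
    (hA : IsC11BoundedOn A C s) (hs : Convex ℝ s) (hC : 0 ≤ C) (hw : C * ‖w‖ ≤ R)
    (hw' : C * ‖w'‖ ≤ R)
    (hsymm : ∀ x ∈ s, ∀ v w, fderiv ℝ A x (A x v) w = fderiv ℝ A x (A x w) v) :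
    ‖γ' 1 - γ 1 - A (γ 1) (w' - w)‖ ≤
      Real.exp R * ((R * (Real.exp R * C) ^ 2 + C * (Real.exp R * C)) * ‖w' - w‖ ^ 2) := by
  have hR : 0 ≤ R := (by positivity : 0 ≤ C * ‖w‖).trans hw
  have h := norm_le_exp_mul_of_norm_deriv_le (K := R)
    (ε := (R * (Real.exp R * C) ^ 2 + C * (Real.exp R * C)) * ‖w' - w‖ ^ 2)
    (f := fun t ↦ γ' t - γ t - t • A (γ t) (w' - w)) hR (by positivity)
    (fun t ht ↦ ((hγ'.hasDerivWithinAt t ht).sub (hγ.hasDerivWithinAt t ht)).sub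
      (hγ.hasDerivWithinAt_smul_apply hA.differentiableAt hsymm (w' - w) ht))
    (by simp [hγ.apply_zero, hγ'.apply_zero]) (fun t ht ↦ ?_) (right_mem_Icc.2 zero_le_one)
  · simpa using h
  have hx := hγ.mem t ht
  have hy := hγ'.mem t ht
  have hdist := hγ.norm_sub_le hγ' hA hs hC hw' ht
  set x := γ t
  set y := γ' t
  set v := w' - w with hv
  have hsplit : A y w' - A x w - (fderiv ℝ A x (t • A x v) w + A x v) =
      (A y - A x - fderiv ℝ A x (y - x)) w + (A y - A x) v
        + fderiv ℝ A x (y - x - t • A x v) w := by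
    simp only [hv, map_sub, sub_apply]
    abel
  calc ‖A y w' - A x w - (fderiv ℝ A x (t • A x v) w + A x v)‖
      ≤ C * ‖y - x‖ ^ 2 * ‖w‖ + C * ‖y - x‖ * ‖v‖ + C * ‖y - x - t • A x v‖ * ‖w‖ := by
        rw [hsplit]
        refine norm_add₃_le.trans (add_le_add_three
          (ContinuousLinearMap.le_of_opNorm_le _ (hA.norm_sub_sub_fderiv_le hC hs hx hy) w)
          (ContinuousLinearMap.le_of_opNorm_le _ (hA.norm_sub_le hs hx hy) v)
          (ContinuousLinearMap.le_of_opNorm_le _ ?_ w))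
        exact ContinuousLinearMap.le_of_opNorm_le _ (hA.norm_fderiv_le x hx) _
    _ = C * ‖w‖ * ‖y - x‖ ^ 2 + C * ‖y - x‖ * ‖v‖ + C * ‖w‖ * ‖y - x - t • A x v‖ := by ring
    _ ≤ R * (Real.exp R * (C * ‖v‖)) ^ 2 + C * (Real.exp R * (C * ‖v‖)) * ‖v‖ +
        R * ‖y - x - t • A x v‖ := by gcongr
    _ = R * ‖y - x - t • A x v‖ +
        (R * (Real.exp R * C) ^ 2 + C * (Real.exp R * C)) * ‖v‖ ^ 2 := by ring

end IsRadialSolution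

/-- The **Frobenius theorem** for total differential equations. -/
theorem exists_hasFDerivAt_of_fderiv_apply_comm [CompleteSpace E] {A : E → V →L[ℝ] E} {x₀ : E}
    {s : Set E} (hs : s ∈ 𝓝 x₀) (hA : ContDiffAt ℝ 2 A x₀)
    (hsymm : ∀ x ∈ s, ∀ v w, fderiv ℝ A x (A x v) w = fderiv ℝ A x (A x w) v) :
    ∃ ε > 0, ∃ f : V → E, f 0 = x₀ ∧ MapsTo f (ball 0 ε) s ∧
      ∀ u ∈ ball (0 : V) ε, HasFDerivAt f (A (f u)) u := by
  obtain ⟨R, hR, C, hC, hRs, hAC⟩ := exists_isC11BoundedOn_closedBall hs hA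
  have hw : ∀ w ∈ ball (0 : V) (R / C), C * ‖w‖ ≤ R := fun w hw ↦ by
    rw [mem_ball_zero_iff, lt_div_iff₀' hC] at hw
    exact hw.le
  choose! γ hγ using fun w hw' ↦ hAC.exists_isRadialSolution hC.le (hw w hw')
  refine ⟨R / C, by positivity, fun w ↦ γ w 1,
    (hγ 0 (mem_ball_self (by positivity))).apply_one_of_zero,
    fun w hw' ↦ hRs ((hγ w hw').mem 1 (right_mem_Icc.2 zero_le_one)), fun u hu ↦ ?_⟩
  rw [hasFDerivAt_iff_isLittleO]
  refine IsBigO.trans_isLittleO (g := fun u' ↦ ‖u' - u‖ ^ 2) ?_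
    ((isLittleO_norm_pow_id one_lt_two).comp_tendsto
      (tendsto_sub_nhds_zero_iff.2 Filter.tendsto_id))
  refine IsBigO.of_bound (Real.exp R * (R * (Real.exp R * C) ^ 2 + C * (Real.exp R * C))) ?_
  filter_upwards [isOpen_ball.mem_nhds hu] with u' hu'
  have := (hγ u hu).norm_sub_sub_le (hγ u' hu') hAC (convex_closedBall _ _) hC.le (hw u hu)
    (hw u' hu') fun x hx ↦ hsymm x (hRs hx)
  simpa [mul_assoc] using this

theorem contDiffOn_of_hasFDerivAt_comp {A : E → V →L[ℝ] E} {f : V → E} {U : Set V} {s : Set E}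
    (hU : IsOpen U) (hA : ContDiffOn ℝ ∞ A s) (hfs : MapsTo f U s)
    (hf : ∀ u ∈ U, HasFDerivAt f (A (f u)) u) : ContDiffOn ℝ ∞ f U := by
  rw [contDiffOn_infty]
  intro k
  induction k with
  | zero => exact contDiffOn_zero.2 fun u hu ↦ (hf u hu).continuousAt.continuousWithinAt
  | succ k ih =>
    rw [Nat.cast_succ, contDiffOn_succ_iff_fderiv_of_isOpen hU]
    refine ⟨fun u hu ↦ (hf u hu).differentiableAt.differentiableWithinAt, by simp, ?_⟩
    exact ((hA.of_le (by exact_mod_cast le_top)).comp ih hfs).congr fun u hu ↦ (hf u hu).fderiv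

end TotalDifferentialEquation

section GeneralizedInverse

open Set Topology ContinuousLinearMap

variable {E K : Type*} [NormedAddCommGroup E] [NormedSpace ℝ E] [NormedAddCommGroup K]
  [NormedSpace ℝ K] {ι : K →L[ℝ] E →L[ℝ] ℝ} {θ θ' : (E →L[ℝ] ℝ) →L[ℝ] E}

/-- The restriction of the form `(ξ, η) ↦ η (θ ξ)` along `ι : K → E*`. -/
def gram (ι : K →L[ℝ] E →L[ℝ] ℝ) (θ : (E →L[ℝ] ℝ) →L[ℝ] E) : K →L[ℝ] K →L[ℝ] ℝ :=
  ι.flip ∘L θ ∘L ι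

/-- The generalized inverse of `θ` with range `ι(K)`, as a bilinear form on `E`. It is meaningful
when `gram ι θ` is invertible, and its kernel, the annihilator of `ι(K)`, does not depend
on `θ`. -/
def gramInverse (ι : K →L[ℝ] E →L[ℝ] ℝ) (θ : (E →L[ℝ] ℝ) →L[ℝ] E) : E →L[ℝ] E →L[ℝ] ℝ :=
  ι ∘L (gram ι θ).inverse ∘L ι.flip

theorem gram_apply (a b : K) : gram ι θ a b = ι b (θ (ι a)) :=
  rfl

theorem gramInverse_apply_apply (h : (gram ι θ).IsInvertible) (v : E) :
    gramInverse ι θ' (θ (gramInverse ι θ v)) = gramInverse ι θ' v := by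
  have : ι.flip (θ (gramInverse ι θ v)) = ι.flip v := h.self_apply_inverse (ι.flip v)
  simp only [gramInverse, comp_apply] at this ⊢
  rw [this]

theorem gramInverse_comm (h : (gram ι θ).IsInvertible)
    (hθ : ∀ ξ η : E →L[ℝ] ℝ, η (θ ξ) = ξ (θ η)) (v w : E) :
    gramInverse ι θ v w = gramInverse ι θ w v := by
  have hself (v w : E) : gramInverse ι θ v w =
      gram ι θ ((gram ι θ).inverse (ι.flip w)) ((gram ι θ).inverse (ι.flip v)) := by
    rw [h.self_apply_inverse]
    rfl
  rw [hself, hself, gram_apply, gram_apply, hθ]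

theorem apply_gramInverse_apply [FiniteDimensional ℝ E] (h : (gram ι θ).IsInvertible)
    (hrank : Module.finrank ℝ (θ : (E →L[ℝ] ℝ) →ₗ[ℝ] E).range = Module.finrank ℝ K)
    (ξ : E →L[ℝ] ℝ) : θ (gramInverse ι θ (θ ξ)) = θ ξ := by
  have hinj : Function.Injective (θ ∘L ι : K →ₗ[ℝ] E) := fun a b hab ↦
    h.injective (congrArg ι.flip hab)
  have hrange : (θ ∘L ι : K →ₗ[ℝ] E).range = (θ : (E →L[ℝ] ℝ) →ₗ[ℝ] E).range := by
    refine Submodule.eq_of_le_of_finrank_eq ?_ ?_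
    · rintro _ ⟨a, rfl⟩
      exact ⟨ι a, rfl⟩
    · rw [hrank, LinearMap.finrank_range_of_inj hinj]
  obtain ⟨a, ha⟩ : θ ξ ∈ (θ ∘L ι : K →ₗ[ℝ] E).range := hrange ▸ ⟨ξ, rfl⟩
  have ha' : θ (ι a) = θ ξ := ha
  rw [← ha']
  exact congrArg (fun a ↦ θ (ι a)) (h.inverse_apply_self a)

theorem isInvertible_gram_subtypeL [FiniteDimensional ℝ E]
    (hθ : ∀ ξ η : E →L[ℝ] ℝ, η (θ ξ) = ξ (θ η)) {C : Submodule ℝ (E →L[ℝ] ℝ)}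
    (hC : IsCompl (θ : (E →L[ℝ] ℝ) →ₗ[ℝ] E).ker C) : (gram C.subtypeL θ).IsInvertible := by
  have hinj : Function.Injective (gram C.subtypeL θ) := by
    refine (injective_iff_map_eq_zero _).2 fun a ha ↦ ?_
    have hθa : θ (a : E →L[ℝ] ℝ) = 0 := by
      refine SeparatingDual.eq_zero_of_forall_dual_eq_zero (R := ℝ) fun ξ ↦ ?_
      obtain ⟨η, hη, b, hb, rfl⟩ := Submodule.mem_sup.1 (hC.sup_eq_top ▸ Submodule.mem_top : ξ ∈ _)
      have hηa : η (θ (a : E →L[ℝ] ℝ)) = 0 := by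
        rw [hθ, show θ η = 0 from hη, map_zero]
      have hba : b (θ (a : E →L[ℝ] ℝ)) = 0 := congrArg (· ⟨b, hb⟩) ha
      rw [add_apply, hηa, hba, add_zero]
    exact Subtype.ext (hC.disjoint.le_bot ⟨hθa, a.2⟩)
  have hdual : Module.finrank ℝ C = Module.finrank ℝ (C →L[ℝ] ℝ) := by
    rw [← (LinearMap.toContinuousLinearMap (𝕜 := ℝ) (E := C) (F' := ℝ)).finrank_eq]
    exact (Subspace.dual_finrank_eq (K := ℝ) (V := C)).symm
  exact ⟨(LinearEquiv.ofInjectiveOfFinrankEq (gram C.subtypeL θ : C →ₗ[ℝ] (C →L[ℝ] ℝ)) hinj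
    hdual).toContinuousLinearEquiv, rfl⟩

theorem isOpen_setOf_isInvertible_gram [CompleteSpace K] :
    IsOpen {θ : (E →L[ℝ] ℝ) →L[ℝ] E | (gram ι θ).IsInvertible} :=
  (ContinuousLinearEquiv.isOpen (E := K) (F := K →L[ℝ] ℝ)).preimage
    (continuous_const.clm_comp (continuous_id.clm_comp continuous_const) : Continuous (gram ι))

theorem contDiffAt_gramInverse [CompleteSpace K] (h : (gram ι θ).IsInvertible) :
    ContDiffAt ℝ ∞ (gramInverse ι) θ := by
  have hgram : ContDiffAt ℝ ∞ (gram ι) θ :=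
    contDiffAt_const.clm_comp (contDiffAt_id.clm_comp contDiffAt_const)
  obtain ⟨e, he⟩ := h
  have hinv : ContDiffAt ℝ ∞ inverse (gram ι θ) := he ▸ contDiffAt_map_inverse e
  exact contDiffAt_const.clm_comp ((hinv.comp θ hgram).clm_comp contDiffAt_const)

/-- `G` is a smooth symmetric generalized inverse of the smooth symmetric `Θ` on the open set `s`,
such that moreover the kernels of the projections `Θ u ∘ G u` are all the same. -/
structure IsGeneralizedInverseOn (Θ : E → (E →L[ℝ] ℝ) →L[ℝ] E) (G : E → E →L[ℝ] E →L[ℝ] ℝ)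
    (s : Set E) : Prop where
  isOpen : IsOpen s
  contDiffOn_tensor : ContDiffOn ℝ ∞ Θ s
  contDiffOn : ContDiffOn ℝ ∞ G s
  tensor_comm : ∀ u ∈ s, ∀ ξ η : E →L[ℝ] ℝ, η (Θ u ξ) = ξ (Θ u η)
  comm : ∀ u ∈ s, ∀ v w, G u v w = G u w v
  apply_tensor_apply : ∀ u ∈ s, ∀ u' ∈ s, ∀ v, G u (Θ u' (G u' v)) = G u v
  tensor_apply_tensor : ∀ u ∈ s, ∀ ξ, Θ u (G u (Θ u ξ)) = Θ u ξ

theorem exists_isGeneralizedInverseOn [FiniteDimensional ℝ E] {Θ : E → (E →L[ℝ] ℝ) →L[ℝ] E}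
    {O : Set E} (hO : IsOpen O) (hΘ : ContDiffOn ℝ ∞ Θ O)
    (hcomm : ∀ u ∈ O, ∀ ξ η : E →L[ℝ] ℝ, η (Θ u ξ) = ξ (Θ u η)) {r : ℕ}
    (hr : ∀ u ∈ O, Module.finrank ℝ (Θ u : (E →L[ℝ] ℝ) →ₗ[ℝ] E).range = r)
    {u₀ : E} (hu₀ : u₀ ∈ O) :
    ∃ (G : E → E →L[ℝ] E →L[ℝ] ℝ) (s : Set E), s ⊆ O ∧ u₀ ∈ s ∧ IsGeneralizedInverseOn Θ G s := by
  obtain ⟨C, hC⟩ := Submodule.exists_isCompl (Θ u₀ : (E →L[ℝ] ℝ) →ₗ[ℝ] E).ker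
  have hCr : Module.finrank ℝ C = r := by
    have := Submodule.finrank_add_eq_of_isCompl hC
    have := (Θ u₀ : (E →L[ℝ] ℝ) →ₗ[ℝ] E).finrank_range_add_finrank_ker
    have := hr u₀ hu₀
    omega
  refine ⟨fun u ↦ gramInverse C.subtypeL (Θ u), O ∩ Θ ⁻¹' {θ | (gram C.subtypeL θ).IsInvertible},
    inter_subset_left, ⟨hu₀, isInvertible_gram_subtypeL (hcomm u₀ hu₀) hC⟩, ?_⟩
  exact
    { isOpen := hΘ.continuousOn.isOpen_inter_preimage hO isOpen_setOf_isInvertible_gram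
      contDiffOn_tensor := hΘ.mono inter_subset_left
      contDiffOn := fun u hu ↦ (contDiffAt_gramInverse hu.2).comp_contDiffWithinAt u
        (hΘ.mono inter_subset_left u hu)
      tensor_comm := fun u hu ↦ hcomm u hu.1
      comm := fun u hu ↦ gramInverse_comm hu.2 (hcomm u hu.1)
      apply_tensor_apply := fun _ _ u' hu' ↦ gramInverse_apply_apply hu'.2
      tensor_apply_tensor := fun u hu ↦
        apply_gramInverse_apply hu.2 ((hr u hu.1).trans hCr.symm) }

end GeneralizedInverse

section Involutivity

open Set Metric Topology ContinuousLinearMap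

variable {V E : Type*} [NormedAddCommGroup V] [NormedSpace ℝ V] [NormedAddCommGroup E]
  [NormedSpace ℝ E]

/-- The projection `P u = Θ u ∘ G u` onto the range of `Θ u` given by a generalized inverse. -/
def rangeProj (Θ : E → (E →L[ℝ] ℝ) →L[ℝ] E) (G : E → E →L[ℝ] E →L[ℝ] ℝ) (u : E) : E →L[ℝ] E :=
  Θ u ∘L G u

/-- Involutivity at `u` of the distribution `range (Θ u)`: for constant `ξ` and `η`, the Lie bracket
of the vector fields `u ↦ Θ u ξ` and `u ↦ Θ u η` lies in the distribution. -/
def IsInvolutiveAt (Θ : E → (E →L[ℝ] ℝ) →L[ℝ] E) (u : E) : Prop :=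
  ∀ ξ η, fderiv ℝ Θ u (Θ u ξ) η - fderiv ℝ Θ u (Θ u η) ξ ∈ range (Θ u)

namespace IsGeneralizedInverseOn

variable {Θ : E → (E →L[ℝ] ℝ) →L[ℝ] E} {G : E → E →L[ℝ] E →L[ℝ] ℝ} {s : Set E} {u : E}

theorem mem_range_iff (h : IsGeneralizedInverseOn Θ G s) (hu : u ∈ s) {v : E} :
    v ∈ range (Θ u) ↔ rangeProj Θ G u v = v := by
  refine ⟨?_, fun hv ↦ ⟨G u v, hv⟩⟩
  rintro ⟨ξ, rfl⟩
  exact h.tensor_apply_tensor u hu ξ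

theorem rangeProj_rangeProj (h : IsGeneralizedInverseOn Θ G s) (hu : u ∈ s) {u' : E} (hu' : u' ∈ s)
    (v : E) : rangeProj Θ G u (rangeProj Θ G u' v) = rangeProj Θ G u v :=
  congrArg (Θ u) (h.apply_tensor_apply u hu u' hu' v)

theorem contDiffOn_rangeProj (h : IsGeneralizedInverseOn Θ G s) :
    ContDiffOn ℝ ∞ (rangeProj Θ G) s :=
  h.contDiffOn_tensor.clm_comp h.contDiffOn

theorem differentiableAt_tensor (h : IsGeneralizedInverseOn Θ G s) (hu : u ∈ s) :
    DifferentiableAt ℝ Θ u :=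
  (h.contDiffOn_tensor.contDiffAt (h.isOpen.mem_nhds hu)).differentiableAt (by simp)

theorem differentiableAt_rangeProj (h : IsGeneralizedInverseOn Θ G s) (hu : u ∈ s) :
    DifferentiableAt ℝ (rangeProj Θ G) u :=
  (h.contDiffOn_rangeProj.contDiffAt (h.isOpen.mem_nhds hu)).differentiableAt (by simp)

theorem fderiv_rangeProj_rangeProj (h : IsGeneralizedInverseOn Θ G s) (hu : u ∈ s) (X w : E) :
    fderiv ℝ (rangeProj Θ G) u X (rangeProj Θ G u w) = fderiv ℝ (rangeProj Θ G) u X w := by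
  have hP := (h.differentiableAt_rangeProj hu).hasFDerivAt
  have hconst : (fun u' ↦ rangeProj Θ G u' (rangeProj Θ G u w)) =ᶠ[𝓝 u]
      fun u' ↦ rangeProj Θ G u' w := by
    filter_upwards [h.isOpen.mem_nhds hu] with u' hu' using h.rangeProj_rangeProj hu' hu w
  have := ((hP.clm_apply (hasFDerivAt_const w u)).congr_of_eventuallyEq hconst).unique
    (hP.clm_apply (hasFDerivAt_const (rangeProj Θ G u w) u))
  simpa using congr($this X).symm

-- Differentiate the identity `P (g b) (Y b) = Y b`.
theorem fderiv_sub_rangeProj_fderiv (h : IsGeneralizedInverseOn Θ G s) {g Y : V → E} {a : V}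
    (ha : g a ∈ s) (hg : DifferentiableAt ℝ g a) (hY : DifferentiableAt ℝ Y a)
    (hmem : ∀ᶠ b in 𝓝 a, Y b ∈ range (Θ (g b))) (w : V) :
    fderiv ℝ Y a w - rangeProj Θ G (g a) (fderiv ℝ Y a w) =
      fderiv ℝ (rangeProj Θ G) (g a) (fderiv ℝ g a w) (Y a) := by
  have hPY := ((h.differentiableAt_rangeProj ha).hasFDerivAt.comp a hg.hasFDerivAt).clm_apply
    hY.hasFDerivAt
  have heq : (fun b ↦ (rangeProj Θ G ∘ g) b (Y b)) =ᶠ[𝓝 a] Y := by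
    filter_upwards [hmem, hg.continuousAt.preimage_mem_nhds (h.isOpen.mem_nhds ha)] with b hb hbs
      using (h.mem_range_iff hbs).1 hb
  have := congr($((hY.hasFDerivAt.congr_of_eventuallyEq heq).unique hPY) w)
  simp only [Function.comp_apply, _root_.add_apply, comp_apply, flip_apply] at this
  rw [sub_eq_iff_eq_add']
  exact this

theorem fderiv_tensor_sub_rangeProj (h : IsGeneralizedInverseOn Θ G s) (hu : u ∈ s) (X : E)
    (ξ : E →L[ℝ] ℝ) :
    fderiv ℝ Θ u X ξ - rangeProj Θ G u (fderiv ℝ Θ u X ξ) =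
      fderiv ℝ (rangeProj Θ G) u X (Θ u ξ) := by
  have hΘ := (h.differentiableAt_tensor hu).hasFDerivAt.clm_apply (hasFDerivAt_const ξ u)
  have := h.fderiv_sub_rangeProj_fderiv (g := id) hu differentiableAt_id hΘ.differentiableAt
    (.of_forall fun u' ↦ ⟨ξ, rfl⟩) X
  simpa [hΘ.fderiv] using this

theorem isInvolutiveAt_iff (h : IsGeneralizedInverseOn Θ G s) (hu : u ∈ s) :
    IsInvolutiveAt Θ u ↔ ∀ ξ η, fderiv ℝ (rangeProj Θ G) u (Θ u ξ) (Θ u η) =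
      fderiv ℝ (rangeProj Θ G) u (Θ u η) (Θ u ξ) := by
  refine forall₂_congr fun ξ η ↦ ?_
  rw [h.mem_range_iff hu, ← h.fderiv_tensor_sub_rangeProj hu, ← h.fderiv_tensor_sub_rangeProj hu,
    map_sub, eq_comm, sub_eq_sub_iff_sub_eq_sub]

theorem isInvolutiveAt_of_range_fderiv_eq (h : IsGeneralizedInverseOn Θ G s) {g : V → E} {a : V}
    (hg : ContDiffAt ℝ 2 g a) (ha : g a ∈ s)
    (hrange : ∀ᶠ b in 𝓝 a, range (fderiv ℝ g b) = range (Θ (g b))) : IsInvolutiveAt Θ (g a) := by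
  have hg' : DifferentiableAt ℝ (fderiv ℝ g) a :=
    (hg.fderiv_right (m := 1) (by norm_num)).differentiableAt (by simp)
  have hY (v : V) := hg'.hasFDerivAt.clm_apply (hasFDerivAt_const v a)
  have hsecond (v w : V) :
      fderiv ℝ (fderiv ℝ g) a w v - rangeProj Θ G (g a) (fderiv ℝ (fderiv ℝ g) a w v) =
        fderiv ℝ (rangeProj Θ G) (g a) (fderiv ℝ g a w) (fderiv ℝ g a v) := by
    have := h.fderiv_sub_rangeProj_fderiv ha (hg.differentiableAt (by simp))
      (hY v).differentiableAt (hrange.mono fun b hb ↦ hb ▸ ⟨v, rfl⟩) w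
    simpa [(hY v).fderiv] using this
  refine (h.isInvolutiveAt_iff ha).2 fun ξ η ↦ ?_
  obtain ⟨v, hv⟩ : Θ (g a) ξ ∈ range (fderiv ℝ g a) := hrange.self_of_nhds ▸ ⟨ξ, rfl⟩
  obtain ⟨w, hw⟩ : Θ (g a) η ∈ range (fderiv ℝ g a) := hrange.self_of_nhds ▸ ⟨η, rfl⟩
  rw [← hv, ← hw, ← hsecond, ← hsecond, (hg.isSymmSndFDerivAt (by simp)).eq v w]

end IsGeneralizedInverseOn

end Involutivity

section IntegralManifolds

open Set Metric Topology ContinuousLinearMap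

variable {V E : Type*} [NormedAddCommGroup V] [NormedSpace ℝ V] [NormedAddCommGroup E]
  [NormedSpace ℝ E]

namespace IsGeneralizedInverseOn

variable {Θ : E → (E →L[ℝ] ℝ) →L[ℝ] E} {G : E → E →L[ℝ] E →L[ℝ] ℝ} {s : Set E} {u x : E}
  {L : V →L[ℝ] E}

theorem fderiv_rangeProj_comp_comm (h : IsGeneralizedInverseOn Θ G s) (hx : x ∈ s)
    (hinv : IsInvolutiveAt Θ x) (v w : V) :
    fderiv ℝ (fun y ↦ rangeProj Θ G y ∘L L) x (rangeProj Θ G x (L v)) w =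
      fderiv ℝ (fun y ↦ rangeProj Θ G y ∘L L) x (rangeProj Θ G x (L w)) v := by
  have hderiv (X : E) (w : V) : fderiv ℝ (fun y ↦ rangeProj Θ G y ∘L L) x X w =
      fderiv ℝ (rangeProj Θ G) x X (rangeProj Θ G x (L w)) := by
    rw [((h.differentiableAt_rangeProj hx).hasFDerivAt.clm_comp (hasFDerivAt_const L x)).fderiv,
      h.fderiv_rangeProj_rangeProj hx]
    simp
  rw [hderiv, hderiv]
  exact (h.isInvolutiveAt_iff hx).1 hinv (G x (L v)) (G x (L w))

theorem rangeProj_rangeProj_apply (h : IsGeneralizedInverseOn Θ G s) (hu : u ∈ s) (hx : x ∈ s)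
    (hL : range L ⊆ range (Θ u)) (v : V) : rangeProj Θ G u (rangeProj Θ G x (L v)) = L v := by
  rw [h.rangeProj_rangeProj hu hx]
  exact (h.mem_range_iff hu).1 (hL ⟨v, rfl⟩)

theorem range_rangeProj_comp (h : IsGeneralizedInverseOn Θ G s) (hu : u ∈ s) (hx : x ∈ s)
    (hL : range L = range (Θ u)) : range (rangeProj Θ G x ∘L L) = range (Θ x) := by
  apply Subset.antisymm
  · rintro _ ⟨v, rfl⟩
    exact ⟨G x (L v), rfl⟩
  · rintro y hy
    obtain ⟨v, hv⟩ : rangeProj Θ G u y ∈ range L := hL ▸ ⟨G u y, rfl⟩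
    refine ⟨v, ?_⟩
    rw [comp_apply, hv, h.rangeProj_rangeProj hx hu, (h.mem_range_iff hx).1 hy]

-- A solution `f` satisfies `(P u ∘ f)' = L`, so `P u ∘ f` is injective.
theorem injOn_of_hasFDerivAt (h : IsGeneralizedInverseOn Θ G s) (hu : u ∈ s)
    (hL : range L ⊆ range (Θ u)) (hLinj : Function.Injective L) {f : V → E} {U : Set V}
    (hU : Convex ℝ U) (hfs : MapsTo f U s)
    (hf : ∀ a ∈ U, HasFDerivAt f (rangeProj Θ G (f a) ∘L L) a) : InjOn f U := by
  have hconst : ∀ a ∈ U, HasFDerivWithinAt (fun a ↦ rangeProj Θ G u (f a) - L a)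
      (0 : V →L[ℝ] E) U a := by
    intro a ha
    have hsub := ((rangeProj Θ G u).hasFDerivAt.comp a (hf a ha)).sub (L.hasFDerivAt (x := a))
    refine (hsub.congr_fderiv ?_).hasFDerivWithinAt
    ext1 v
    simpa [sub_eq_zero] using h.rangeProj_rangeProj_apply hu (hfs ha) hL v
  intro a ha b hb hab
  have := hU.norm_image_sub_le_of_norm_hasFDerivWithin_le (𝕜 := ℝ) (C := 0) hconst (by simp) ha hb
  simp only [zero_mul, norm_le_zero_iff, hab, sub_sub_sub_cancel_left, sub_eq_zero] at this
  exact hLinj this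

theorem exists_integralManifold [FiniteDimensional ℝ E] (h : IsGeneralizedInverseOn Θ G s)
    (hinv : ∀ u ∈ s, IsInvolutiveAt Θ u) (hu : u ∈ s) :
    ∃ (k : ℕ) (U : Set (EuclideanSpace ℝ (Fin k))) (f : EuclideanSpace ℝ (Fin k) → E),
      IsOpen U ∧ ContDiffOn ℝ ∞ f U ∧ InjOn f U ∧ MapsTo f U s ∧ u ∈ f '' U ∧
        ∀ a ∈ U, Function.Injective (fderiv ℝ f a) ∧ range (fderiv ℝ f a) = range (Θ (f a)) := by
  let D : Submodule ℝ E := (Θ u : (E →L[ℝ] ℝ) →ₗ[ℝ] E).range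
  let e : EuclideanSpace ℝ (Fin (Module.finrank ℝ D)) ≃L[ℝ] D :=
    ContinuousLinearEquiv.ofFinrankEq (by simp)
  let L : EuclideanSpace ℝ (Fin (Module.finrank ℝ D)) →L[ℝ] E := D.subtypeL ∘L e
  have hLinj : Function.Injective L := Subtype.val_injective.comp e.injective
  have hL : range L = range (Θ u) :=
    (e.surjective.range_comp ((↑) : D → E)).trans Subtype.range_coe
  have hA : ContDiffOn ℝ ∞ (fun y ↦ rangeProj Θ G y ∘L L) s :=
    h.contDiffOn_rangeProj.clm_comp contDiffOn_const
  have hs := h.isOpen.mem_nhds hu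
  obtain ⟨ε, hε, f, hf0, hfs, hf⟩ := exists_hasFDerivAt_of_fderiv_apply_comm hs
    ((hA.contDiffAt hs).of_le ENat.LEInfty.out)
    fun x hx ↦ h.fderiv_rangeProj_comp_comm hx (hinv x hx)
  refine ⟨_, ball 0 ε, f, isOpen_ball, contDiffOn_of_hasFDerivAt_comp isOpen_ball hA hfs hf,
    h.injOn_of_hasFDerivAt hu hL.subset hLinj (convex_ball 0 ε) hfs hf, hfs,
    ⟨0, mem_ball_self hε, hf0⟩, fun a ha ↦ ?_⟩
  rw [(hf a ha).fderiv]
  refine ⟨fun v w hvw ↦ hLinj ?_, h.range_rangeProj_comp hu (hfs ha) hL⟩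
  rw [← h.rangeProj_rangeProj_apply hu (hfs ha) hL.subset v,
    ← h.rangeProj_rangeProj_apply hu (hfs ha) hL.subset w]
  exact congrArg (rangeProj Θ G u) hvw

end IsGeneralizedInverseOn

end IntegralManifolds

section Christoffel

open Set Topology ContinuousLinearMap

variable {E : Type*} [NormedAddCommGroup E] [NormedSpace ℝ E]

/-- The Christoffel symbols at a point of a connection that makes a symmetric tensor parallel, in
terms of the value `θ` and the derivative `T` of the tensor and of a generalized inverse `g` of
`θ`. Their component along the kernel of `P = θ g` is forced by parallelism and symmetry on pairs
with an entry in the range of `P`, and is chosen to be `0` on pairs in the kernel; the component in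
the range is given by the Koszul formula for the form `g`, with `-g T g` for its derivative. -/
def christoffelAt (θ : (E →L[ℝ] ℝ) →L[ℝ] E) (g : E →L[ℝ] E →L[ℝ] ℝ)
    (T : E →L[ℝ] (E →L[ℝ] ℝ) →L[ℝ] E) : E →L[ℝ] E →L[ℝ] E :=
  let P : E →L[ℝ] E := θ ∘L g
  let Q : E →L[ℝ] E := .id ℝ E - P
  let B : E →L[ℝ] E →L[ℝ] E := (compL ℝ E (E →L[ℝ] ℝ) E).flip g ∘L T
  let c : E →L[ℝ] E →L[ℝ] E →L[ℝ] ℝ :=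
    (compL ℝ E (E →L[ℝ] E) (E →L[ℝ] ℝ)).flip B.flip ∘L compL ℝ E E ℝ ∘L g;
  -(compL ℝ E E E Q ∘L (B + B.flip - B ∘L P) + (1 / 2 : ℝ) •
    (compL ℝ E E E P ∘L (B + B.flip) - compL ℝ E (E →L[ℝ] ℝ) E θ ∘L c))

theorem christoffelAt_apply (θ : (E →L[ℝ] ℝ) →L[ℝ] E) (g : E →L[ℝ] E →L[ℝ] ℝ)
    (T : E →L[ℝ] (E →L[ℝ] ℝ) →L[ℝ] E) (X Y : E) :
    christoffelAt θ g T X Y =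
      -((T X (g Y) + T Y (g X) - T (θ (g X)) (g Y)
          - θ (g (T X (g Y) + T Y (g X) - T (θ (g X)) (g Y))))
        + (1 / 2 : ℝ) • (θ (g (T X (g Y) + T Y (g X))) - θ (g X ∘L T.flip (g Y)))) := by
  have : ((compL ℝ E (E →L[ℝ] ℝ) E).flip g ∘L T).flip Y = T.flip (g Y) := rfl
  simp only [christoffelAt, neg_apply, _root_.add_apply, comp_apply, _root_.sub_apply, compL_apply,
    flip_apply, _root_.smul_apply, ContinuousLinearMap.id_apply, this]

variable {θ : (E →L[ℝ] ℝ) →L[ℝ] E} {g : E →L[ℝ] E →L[ℝ] ℝ} {T : E →L[ℝ] (E →L[ℝ] ℝ) →L[ℝ] E}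

theorem christoffelAt_comm (hθg : ∀ ξ, θ (g (θ ξ)) = θ ξ)
    (hT : ∀ X (ξ η : E →L[ℝ] ℝ), η (T X ξ) = ξ (T X η))
    (hinv : ∀ ξ η, T (θ ξ) η - T (θ η) ξ ∈ range θ) (X Y : E) :
    christoffelAt θ g T X Y = christoffelAt θ g T Y X := by
  have hform : g X ∘L T.flip (g Y) = g Y ∘L T.flip (g X) := by
    ext Z
    exact hT _ _ _
  obtain ⟨ζ, hζ⟩ := hinv (g X) (g Y)
  have hQ := hθg ζ
  rw [hζ, map_sub, map_sub] at hQ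
  rw [christoffelAt_apply, christoffelAt_apply, hform]
  simp only [map_sub, map_add]
  linear_combination (norm := module) -hQ

theorem apply_apply_of_mem_range (hθ : ∀ ξ η : E →L[ℝ] ℝ, η (θ ξ) = ξ (θ η))
    (hg : ∀ v w, g v w = g w v) (hθg : ∀ ξ, θ (g (θ ξ)) = θ ξ) {z : E} (hz : z ∈ range θ)
    (η : E →L[ℝ] ℝ) : g (θ η) z = η z := by
  obtain ⟨ζ, rfl⟩ := hz
  rw [hg, hθ, hθg]

theorem apply_christoffelAt_apply (hθ : ∀ ξ η : E →L[ℝ] ℝ, η (θ ξ) = ξ (θ η))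
    (hg : ∀ v w, g v w = g w v) (hθg : ∀ ξ, θ (g (θ ξ)) = θ ξ)
    (hT : ∀ X (ξ η : E →L[ℝ] ℝ), η (T X ξ) = ξ (T X η))
    (hTg : ∀ X ξ, T X ξ - T X (g (θ ξ)) ∈ range θ)
    (hinv : ∀ ξ η, T (θ ξ) η - T (θ η) ξ ∈ range θ) (X : E) (ξ η : E →L[ℝ] ℝ) :
    η (christoffelAt θ g T X (θ ξ)) =
      -(η (T X (g (θ ξ))) - g (θ η) (T X (g (θ ξ)))
        + (1 / 2 : ℝ) * (g (θ η) (T X (g (θ ξ))) + g (θ η) (T (θ ξ) (g X))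
          - g (θ ξ) (T (θ η) (g X)))) := by
  have hηg (v : E) : η (θ (g v)) = g (θ η) v := by rw [hθ, hg]
  have hmem : T (θ ξ) (g X) - T (θ (g X)) (g (θ ξ)) ∈ range θ := by
    obtain ⟨ζ₁, h₁⟩ := hinv ξ (g X)
    obtain ⟨ζ₂, h₂⟩ := hTg (θ (g X)) ξ
    exact ⟨ζ₁ + ζ₂, by rw [map_add, h₁, h₂, sub_add_sub_cancel]⟩
  have hQ := apply_apply_of_mem_range hθ hg hθg hmem η
  have hform : η (θ (g X ∘L T.flip (g (θ ξ)))) = g (θ ξ) (T (θ η) (g X)) := by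
    rw [hθ]
    exact hT _ _ _
  rw [christoffelAt_apply]
  simp only [map_sub, map_add, map_neg, map_smul, smul_eq_mul, hform, hηg] at hQ ⊢
  linarith

theorem christoffelAt_parallel (hθ : ∀ ξ η : E →L[ℝ] ℝ, η (θ ξ) = ξ (θ η))
    (hg : ∀ v w, g v w = g w v) (hθg : ∀ ξ, θ (g (θ ξ)) = θ ξ)
    (hT : ∀ X (ξ η : E →L[ℝ] ℝ), η (T X ξ) = ξ (T X η))
    (hTg : ∀ X ξ, T X ξ - T X (g (θ ξ)) ∈ range θ)
    (hinv : ∀ ξ η, T (θ ξ) η - T (θ η) ξ ∈ range θ) (X : E) (ξ : E →L[ℝ] ℝ) :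
    T X ξ + christoffelAt θ g T X (θ ξ) + θ (ξ ∘L christoffelAt θ g T X) = 0 := by
  refine SeparatingDual.eq_zero_of_forall_dual_eq_zero (R := ℝ) fun η ↦ ?_
  have hdual : η (θ (ξ ∘L christoffelAt θ g T X)) = ξ (christoffelAt θ g T X (θ η)) := by
    rw [hθ]
    rfl
  have hQξ := apply_apply_of_mem_range hθ hg hθg (hTg X ξ) η
  have hQη := apply_apply_of_mem_range hθ hg hθg (hTg X η) ξ
  rw [map_add, map_add, hdual, apply_christoffelAt_apply hθ hg hθg hT hTg hinv,
    apply_christoffelAt_apply hθ hg hθg hT hTg hinv]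
  simp only [map_sub] at hQξ hQη
  linarith [hT X (g (θ ξ)) (g (θ η)), hT X ξ (g (θ η)), hT X ξ η]

/-- The Christoffel symbols, in the domain of a generalized inverse `G` of `Θ`, of a connection
for which `Θ` is parallel. -/
def christoffel (Θ : E → (E →L[ℝ] ℝ) →L[ℝ] E) (G : E → E →L[ℝ] E →L[ℝ] ℝ) (u : E) :
    E →L[ℝ] E →L[ℝ] E :=
  christoffelAt (Θ u) (G u) (fderiv ℝ Θ u)

namespace IsGeneralizedInverseOn

variable {Θ : E → (E →L[ℝ] ℝ) →L[ℝ] E} {G : E → E →L[ℝ] E →L[ℝ] ℝ} {s : Set E} {u : E}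

theorem contDiffOn_christoffel [FiniteDimensional ℝ E] (h : IsGeneralizedInverseOn Θ G s) :
    ContDiffOn ℝ ∞ (christoffel Θ G) s := by
  have hΘ := h.contDiffOn_tensor
  have hT : ContDiffOn ℝ ∞ (fderiv ℝ Θ) s := hΘ.fderiv_of_isOpen h.isOpen (by simp)
  have hG (X : E) : ContDiffOn ℝ ∞ (fun u ↦ G u X) s := h.contDiffOn.clm_apply contDiffOn_const
  have hTG (X Y : E) : ContDiffOn ℝ ∞ (fun u ↦ fderiv ℝ Θ u X (G u Y)) s :=
    (hT.clm_apply contDiffOn_const).clm_apply (hG Y)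
  have hTPG (X Y : E) : ContDiffOn ℝ ∞ (fun u ↦ fderiv ℝ Θ u (Θ u (G u X)) (G u Y)) s :=
    (hT.clm_apply (hΘ.clm_apply (hG X))).clm_apply (hG Y)
  have hP {f : E → E} (hf : ContDiffOn ℝ ∞ f s) : ContDiffOn ℝ ∞ (fun u ↦ Θ u (G u (f u))) s :=
    hΘ.clm_apply (h.contDiffOn.clm_apply hf)
  refine contDiffOn_clm_apply.2 fun X ↦ contDiffOn_clm_apply.2 fun Y ↦ ?_
  have hform : ContDiffOn ℝ ∞ (fun u ↦ G u X ∘L (fderiv ℝ Θ u).flip (G u Y)) s :=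
    contDiffOn_clm_apply.2 fun Z ↦ (hG X).clm_apply (hTG Z Y)
  have hsum := (hTG X Y).add (hTG Y X)
  have hdiff := hsum.sub (hTPG X Y)
  simp only [christoffel, christoffelAt_apply]
  exact ((hdiff.sub (hP hdiff)).add
    (contDiffOn_const.smul ((hP hsum).sub (hΘ.clm_apply hform)))).neg

theorem fderiv_tensor_comm (h : IsGeneralizedInverseOn Θ G s) (hu : u ∈ s) (X : E)
    (ξ η : E →L[ℝ] ℝ) : η (fderiv ℝ Θ u X ξ) = ξ (fderiv ℝ Θ u X η) := by
  have hderiv (ξ η : E →L[ℝ] ℝ) := η.hasFDerivAt.comp u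
    ((h.differentiableAt_tensor hu).hasFDerivAt.clm_apply (hasFDerivAt_const ξ u))
  have hcomm : (fun v ↦ η (Θ v ξ)) =ᶠ[𝓝 u] fun v ↦ ξ (Θ v η) := by
    filter_upwards [h.isOpen.mem_nhds hu] with v hv using h.tensor_comm v hv ξ η
  simpa using congr($((hderiv ξ η).unique ((hderiv η ξ).congr_of_eventuallyEq hcomm)) X)

theorem fderiv_tensor_sub_mem_range (h : IsGeneralizedInverseOn Θ G s) (hu : u ∈ s) (X : E)
    (ξ : E →L[ℝ] ℝ) : fderiv ℝ Θ u X ξ - fderiv ℝ Θ u X (G u (Θ u ξ)) ∈ range (Θ u) := by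
  have h₁ := h.fderiv_tensor_sub_rangeProj hu X ξ
  have h₂ := h.fderiv_tensor_sub_rangeProj hu X (G u (Θ u ξ))
  rw [h.tensor_apply_tensor u hu, ← h₁] at h₂
  rw [h.mem_range_iff hu, map_sub, ← sub_eq_zero]
  linear_combination (norm := module) h₂

theorem christoffel_comm (h : IsGeneralizedInverseOn Θ G s) (hu : u ∈ s)
    (hinv : IsInvolutiveAt Θ u) (X Y : E) : christoffel Θ G u X Y = christoffel Θ G u Y X :=
  christoffelAt_comm (h.tensor_apply_tensor u hu) (h.fderiv_tensor_comm hu) hinv X Y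

theorem christoffel_parallel (h : IsGeneralizedInverseOn Θ G s) (hu : u ∈ s)
    (hinv : IsInvolutiveAt Θ u) (X : E) (ξ : E →L[ℝ] ℝ) :
    fderiv ℝ Θ u X ξ + christoffel Θ G u X (Θ u ξ) + Θ u (ξ ∘L christoffel Θ G u X) = 0 :=
  christoffelAt_parallel (h.tensor_comm u hu) (h.comm u hu) (h.tensor_apply_tensor u hu)
    (h.fderiv_tensor_comm hu) (h.fderiv_tensor_sub_mem_range hu) hinv X ξ

end IsGeneralizedInverseOn

end Christoffel

section Charts

open Set Topology ContinuousLinearMap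

variable {E H M : Type*} [NormedAddCommGroup E] [NormedSpace ℝ E] [TopologicalSpace H]
  {I : ModelWithCorners ℝ E H} [TopologicalSpace M] [ChartedSpace H M] [IsManifold I ∞ M]
  {c x : M}

variable (I c x) in
/-- The derivative at `x` of the chart at `c`; it is `0` outside the source of the chart. -/
def chartDiff : TangentSpace I x →L[ℝ] E :=
  (trivializationAt E (TangentSpace I) c).continuousLinearMapAt ℝ x

variable (I c x) in
/-- The inverse of the derivative at `x` of the chart at `c`. -/
def chartDiffSymm : E →L[ℝ] TangentSpace I x :=
  (trivializationAt E (TangentSpace I) c).symmL ℝ x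

theorem mem_baseSet_trivializationAt_iff :
    x ∈ (trivializationAt E (TangentSpace I : M → Type _) c).baseSet ↔
      x ∈ (extChartAt I c).source := by
  simp

theorem chartDiffSymm_chartDiff (hx : x ∈ (extChartAt I c).source) (v : TangentSpace I x) :
    chartDiffSymm I c x (chartDiff I c x v) = v :=
  Trivialization.symmL_continuousLinearMapAt _ (mem_baseSet_trivializationAt_iff.2 hx) v

theorem chartDiff_chartDiffSymm (hx : x ∈ (extChartAt I c).source) (v : E) :
    chartDiff I c x (chartDiffSymm I c x v) = v :=
  Trivialization.continuousLinearMapAt_symmL _ (mem_baseSet_trivializationAt_iff.2 hx) v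

theorem chartDiff_injective (hx : x ∈ (extChartAt I c).source) :
    Function.Injective (chartDiff I c x) :=
  Function.LeftInverse.injective (chartDiffSymm_chartDiff hx)

theorem chartDiffSymm_injective (hx : x ∈ (extChartAt I c).source) :
    Function.Injective (chartDiffSymm I c x) :=
  Function.LeftInverse.injective (chartDiff_chartDiffSymm hx)

theorem trivializationAt_apply_snd (hx : x ∈ (extChartAt I c).source) (v : TangentSpace I x) :
    (trivializationAt E (TangentSpace I) c ⟨x, v⟩).2 = chartDiff I c x v :=
  congr($(Trivialization.coe_linearMapAt_of_mem (R := ℝ) _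
    (mem_baseSet_trivializationAt_iff.2 hx)) v).symm

theorem hasMFDerivAt_extChartAt (hx : x ∈ (extChartAt I c).source) :
    HasMFDerivAt I 𝓘(ℝ, E) (extChartAt I c) x (chartDiff I c x) := by
  rw [extChartAt_source] at hx
  have h := (mdifferentiableAt_extChartAt (I := I) hx).hasMFDerivAt
  rwa [← TangentBundle.continuousLinearMapAt_trivializationAt hx] at h

theorem fderiv_extChartAt_comp {F : Type*} [NormedAddCommGroup F] [NormedSpace ℝ F] {f : F → M}
    {b : F} (hb : f b ∈ (extChartAt I c).source) (hf : MDiffAt f b) (v : F) :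
    fderiv ℝ (extChartAt I c ∘ f) b v = chartDiff I c (f b) (mfderiv% f b v) :=
  congr($(mfderiv_eq_fderiv.symm.trans
    ((hasMFDerivAt_extChartAt hb).comp b hf.hasMFDerivAt).mfderiv) v)

theorem hasMFDerivAt_extChartAt_symm [I.Boundaryless] {u : E} (hu : u ∈ (extChartAt I c).target) :
    HasMFDerivAt 𝓘(ℝ, E) I (extChartAt I c).symm u
      (chartDiffSymm I c ((extChartAt I c).symm u)) := by
  have hx := (extChartAt I c).map_target hu
  have h := (mdifferentiableWithinAt_extChartAt_symm hu).hasMFDerivWithinAt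
  rw [extChartAt_source] at hx
  rw [I.range_eq_univ] at h
  have hderiv := TangentBundle.symmL_trivializationAt (I := I) hx
  rw [(extChartAt I c).right_inv hu, I.range_eq_univ] at hderiv
  rw [chartDiffSymm, hderiv]
  exact hasMFDerivWithinAt_univ.1 h

section Functions

variable {V : Type*} [NormedAddCommGroup V] [NormedSpace ℝ V] {F : M → V}

theorem contDiffOn_comp_extChartAt_symm {s : Set E} (hst : s ⊆ (extChartAt I c).target)
    (hF : CMDiff[(extChartAt I c).source ∩ extChartAt I c ⁻¹' s] ∞ F) :
    ContDiffOn ℝ ∞ (F ∘ (extChartAt I c).symm) s := by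
  refine contMDiffOn_iff_contDiffOn.1 (hF.comp ((contMDiffOn_extChartAt_symm c).mono hst)
    fun u hu ↦ ⟨(extChartAt I c).map_target (hst hu), ?_⟩)
  rwa [mem_preimage, (extChartAt I c).right_inv (hst hu)]

variable [I.Boundaryless]

theorem mdifferentiableAt_iff_comp_extChartAt_symm (hx : x ∈ (extChartAt I c).source) :
    MDiffAt F x ↔ DifferentiableAt ℝ (F ∘ (extChartAt I c).symm) (extChartAt I c x) := by
  rw [← mdifferentiableAt_iff_differentiableAt]
  refine ⟨fun h ↦ ?_, fun h ↦ ?_⟩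
  · rw [← (extChartAt I c).left_inv hx] at h
    exact h.comp _ (hasMFDerivAt_extChartAt_symm ((extChartAt I c).map_source hx)).mdifferentiableAt
  · refine (h.comp x (hasMFDerivAt_extChartAt hx).mdifferentiableAt).congr_of_eventuallyEq ?_
    filter_upwards [extChartAt_source_mem_nhds' hx] with y hy
    simp only [Function.comp_apply, (extChartAt I c).left_inv hy]

theorem mvfderiv_eq_fderiv_comp_extChartAt_symm (hx : x ∈ (extChartAt I c).source)
    (hF : MDiffAt F x) (v : TangentSpace I x) :
    mvfderiv I F x v =
      fderiv ℝ (F ∘ (extChartAt I c).symm) (extChartAt I c x) (chartDiff I c x v) := by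
  have hF' := ((mdifferentiableAt_iff_comp_extChartAt_symm hx).1 hF).hasFDerivAt.hasMFDerivAt
  have hcomp := hF'.comp x (hasMFDerivAt_extChartAt hx)
  have heq : F =ᶠ[𝓝 x] (F ∘ (extChartAt I c).symm) ∘ extChartAt I c := by
    filter_upwards [extChartAt_source_mem_nhds' hx] with y hy
    simp only [Function.comp_apply, (extChartAt I c).left_inv hy]
  rw [mvfderiv, (hcomp.congr_of_eventuallyEq heq).mfderiv]
  rfl

end Functions

variable (I c) in
/-- The coordinate representation of a vector field in the chart at `c`. -/
def localVec (Y : Π y : M, TangentSpace I y) (u : E) : E :=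
  chartDiff I c ((extChartAt I c).symm u) (Y ((extChartAt I c).symm u))

variable (I c) in
/-- The coordinate representation of a `1`-form in the chart at `c`. -/
def localForm (α : Π y : M, TangentSpace I y →L[ℝ] ℝ) (u : E) : E →L[ℝ] ℝ :=
  α ((extChartAt I c).symm u) ∘L chartDiffSymm I c ((extChartAt I c).symm u)

variable (I c) in
/-- The coordinate representation of a `(2,0)` tensor field in the chart at `c`. -/
def localTensor (Θ : Π y : M, (TangentSpace I y →L[ℝ] ℝ) →L[ℝ] TangentSpace I y) (u : E) :
    (E →L[ℝ] ℝ) →L[ℝ] E :=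
  chartDiff I c ((extChartAt I c).symm u) ∘L Θ ((extChartAt I c).symm u) ∘L
    precomp ℝ (chartDiff I c ((extChartAt I c).symm u))

theorem localVec_extChartAt (hx : x ∈ (extChartAt I c).source) (Y : Π y : M, TangentSpace I y) :
    localVec I c Y (extChartAt I c x) = chartDiff I c x (Y x) := by
  rw [localVec, (extChartAt I c).left_inv hx]

theorem localForm_extChartAt (hx : x ∈ (extChartAt I c).source)
    (α : Π y : M, TangentSpace I y →L[ℝ] ℝ) :
    localForm I c α (extChartAt I c x) = α x ∘L chartDiffSymm I c x := by
  rw [localForm, (extChartAt I c).left_inv hx]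

theorem localForm_comp_chartDiff (ξ : E →L[ℝ] ℝ) {u : E} (hu : u ∈ (extChartAt I c).target) :
    localForm I c (fun y : M ↦ ξ ∘L chartDiff I c y) u = ξ := by
  ext v
  exact congr(ξ $(chartDiff_chartDiffSymm ((extChartAt I c).map_target hu) v))

theorem localForm_localVec {u : E} (hu : u ∈ (extChartAt I c).target)
    (α : Π y : M, TangentSpace I y →L[ℝ] ℝ) (Y : Π y : M, TangentSpace I y) :
    localForm I c α u (localVec I c Y u) =
      α ((extChartAt I c).symm u) (Y ((extChartAt I c).symm u)) :=
  congr(α _ $(chartDiffSymm_chartDiff ((extChartAt I c).map_target hu) _))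

variable {Θ : Π y : M, (TangentSpace I y →L[ℝ] ℝ) →L[ℝ] TangentSpace I y}

theorem localTensor_extChartAt (hx : x ∈ (extChartAt I c).source) (ξ : E →L[ℝ] ℝ) :
    localTensor I c Θ (extChartAt I c x) ξ = chartDiff I c x (Θ x (ξ ∘L chartDiff I c x)) := by
  rw [localTensor, (extChartAt I c).left_inv hx]
  rfl

theorem localTensor_localForm {u : E} (hu : u ∈ (extChartAt I c).target)
    (α : Π y : M, TangentSpace I y →L[ℝ] ℝ) :
    localTensor I c Θ u (localForm I c α u) = localVec I c (fun y ↦ Θ y (α y)) u := by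
  refine congr(chartDiff I c _ (Θ _ $(?_)))
  ext v
  exact congr(α _ $(chartDiffSymm_chartDiff ((extChartAt I c).map_target hu) v))

theorem chartDiff_apply_tensor (hx : x ∈ (extChartAt I c).source) (ξ : TangentSpace I x →L[ℝ] ℝ) :
    chartDiff I c x (Θ x ξ) = localTensor I c Θ (extChartAt I c x) (ξ ∘L chartDiffSymm I c x) := by
  rw [localTensor_extChartAt hx]
  refine congr(chartDiff I c x (Θ x $(?_)))
  ext v
  exact congr(ξ $(chartDiffSymm_chartDiff hx v)).symm

theorem mdifferentiableAt_vectorField_iff [I.Boundaryless] (hx : x ∈ (extChartAt I c).source)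
    {Y : Π y : M, TangentSpace I y} :
    MDiffAt (T% Y) x ↔ DifferentiableAt ℝ (localVec I c Y) (extChartAt I c x) := by
  rw [Trivialization.mdifferentiableAt_section_iff I (trivializationAt E (TangentSpace I) c) _
    (mem_baseSet_trivializationAt_iff.2 hx), mdifferentiableAt_iff_comp_extChartAt_symm hx]
  refine Filter.EventuallyEq.differentiableAt_iff ?_
  filter_upwards [extChartAt_target_mem_nhds' ((extChartAt I c).map_source hx)] with u hu
  exact trivializationAt_apply_snd ((extChartAt I c).map_target hu) _

theorem contDiffOn_localVec {Y : Π y : M, TangentSpace I y} {s : Set E}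
    (hs : IsOpen s) (hst : s ⊆ (extChartAt I c).target)
    (hY : CMDiff[(extChartAt I c).source ∩ extChartAt I c ⁻¹' s] ∞ (T% Y)) :
    ContDiffOn ℝ ∞ (localVec I c Y) s := by
  have h := (Trivialization.contMDiffOn_section_iff (trivializationAt E (TangentSpace I) c)
    (isOpen_extChartAt_preimage' c hs) fun x hx ↦ mem_baseSet_trivializationAt_iff.2 hx.1).1 hY
  exact (contDiffOn_comp_extChartAt_symm hst h).congr fun u hu ↦
    (trivializationAt_apply_snd ((extChartAt I c).map_target (hst hu)) _).symm

section DualBundle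

theorem trivializationAt_dual_apply_snd (α : TangentSpace I x →L[ℝ] ℝ) :
    (trivializationAt (E →L[ℝ] ℝ) (fun z : M ↦ TangentSpace I z →L[ℝ] ℝ) c ⟨x, α⟩).2 =
      α ∘L chartDiffSymm I c x := by
  ext v
  exact congr($(Trivial.continuousLinearMapAt_trivialization ℝ M ℝ x) (α (chartDiffSymm I c x v)))

theorem symmL_trivializationAt_dual (hx : x ∈ (extChartAt I c).source) (ξ : E →L[ℝ] ℝ) :
    Trivialization.symmL ℝ (trivializationAt (E →L[ℝ] ℝ)
      (fun z : M ↦ TangentSpace I z →L[ℝ] ℝ) c) x ξ = ξ ∘L chartDiff I c x := by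
  set e := trivializationAt (E →L[ℝ] ℝ) (fun z : M ↦ TangentSpace I z →L[ℝ] ℝ) c
  have hxe : x ∈ e.baseSet := ⟨mem_baseSet_trivializationAt_iff.2 hx, trivial⟩
  have happly : e.continuousLinearMapAt ℝ x (ξ ∘L chartDiff I c x) = ξ := by
    refine congr($(Trivialization.coe_linearMapAt_of_mem e hxe) _).trans
      ((trivializationAt_dual_apply_snd _).trans ?_)
    ext v
    exact congr(ξ $(chartDiff_chartDiffSymm hx v))
  exact congr(e.symmL ℝ x $(happly)).symm.trans (e.symmL_continuousLinearMapAt hxe _)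

end DualBundle

end Charts

section TensorCharts

open Set Topology ContinuousLinearMap

variable {n : ℕ} {M : Type*} [TopologicalSpace M] [ChartedSpace (EuclideanSpace ℝ (Fin n)) M]
  [IsManifold (𝓡 n) ∞ M] {c x : M} {Θ : Tensor20 n M}

theorem OneForm.differentiableAt_iff (hx : x ∈ (extChartAt (𝓡 n) c).source) {α : OneForm n M} :
    α.DifferentiableAt x ↔
      _root_.DifferentiableAt ℝ (localForm (𝓡 n) c α) (extChartAt (𝓡 n) c x) := by
  rw [OneForm.DifferentiableAt, Trivialization.mdifferentiableAt_section_iff (𝓡 n)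
    (trivializationAt (EuclideanSpace ℝ (Fin n) →L[ℝ] ℝ)
      (fun z : M ↦ TangentSpace (𝓡 n) z →L[ℝ] ℝ) c) _
    ⟨mem_baseSet_trivializationAt_iff.2 hx, trivial⟩, mdifferentiableAt_iff_comp_extChartAt_symm hx]
  exact Filter.EventuallyEq.differentiableAt_iff
    (.of_forall fun u ↦ trivializationAt_dual_apply_snd _)

theorem OneForm.differentiableAt_comp_chartDiff (hx : x ∈ (extChartAt (𝓡 n) c).source)
    (ξ : EuclideanSpace ℝ (Fin n) →L[ℝ] ℝ) :
    OneForm.DifferentiableAt (n := n) (fun y : M ↦ ξ ∘L chartDiff (𝓡 n) c y) x := by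
  rw [OneForm.differentiableAt_iff hx]
  refine (differentiableAt_const ξ).congr_of_eventuallyEq ?_
  filter_upwards [extChartAt_target_mem_nhds' (I := 𝓡 n) ((extChartAt (𝓡 n) c).map_source hx)]
    with u hu using localForm_comp_chartDiff ξ hu

namespace Tensor20

theorem IsSmooth.contDiffOn_localTensor (hΘ : Θ.IsSmooth) :
    ContDiffOn ℝ ∞ (localTensor (𝓡 n) c Θ) (extChartAt (𝓡 n) c).target := by
  have h := (Trivialization.contMDiffOn_section_iff (IB := 𝓡 n) (n := ∞) (trivializationAt
    ((EuclideanSpace ℝ (Fin n) →L[ℝ] ℝ) →L[ℝ] EuclideanSpace ℝ (Fin n))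
    (fun z : M ↦ (TangentSpace (𝓡 n) z →L[ℝ] ℝ) →L[ℝ] TangentSpace (𝓡 n) z) c)
    (isOpen_extChartAt_preimage' c (isOpen_extChartAt_target (I := 𝓡 n) c)) fun x hx ↦
      ⟨⟨mem_baseSet_trivializationAt_iff.2 hx.1, trivial⟩,
      mem_baseSet_trivializationAt_iff.2 hx.1⟩).1 hΘ.contMDiffOn
  refine (contDiffOn_comp_extChartAt_symm subset_rfl h).congr fun u hu ↦ ?_
  ext1 ξ
  exact congr(chartDiff (𝓡 n) c _ (Θ _
    $(symmL_trivializationAt_dual ((extChartAt (𝓡 n) c).map_target hu) ξ))).symm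

theorem IsSmooth.differentiableAt_localTensor (hΘ : Θ.IsSmooth)
    (hx : x ∈ (extChartAt (𝓡 n) c).source) :
    DifferentiableAt ℝ (localTensor (𝓡 n) c Θ) (extChartAt (𝓡 n) c x) :=
  (hΘ.contDiffOn_localTensor.contDiffAt (extChartAt_target_mem_nhds' (I := 𝓡 n)
    ((extChartAt (𝓡 n) c).map_source hx))).differentiableAt (by simp)

theorem range_localTensor (hx : x ∈ (extChartAt (𝓡 n) c).source) :
    (localTensor (𝓡 n) c Θ (extChartAt (𝓡 n) c x) :
      (EuclideanSpace ℝ (Fin n) →L[ℝ] ℝ) →ₗ[ℝ] EuclideanSpace ℝ (Fin n)).range =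
    (Θ.image x).map
      (chartDiff (𝓡 n) c x : TangentSpace (𝓡 n) x →ₗ[ℝ] EuclideanSpace ℝ (Fin n)) := by
  ext w
  constructor
  · rintro ⟨ξ, rfl⟩
    exact ⟨_, ⟨ξ ∘L chartDiff (𝓡 n) c x, rfl⟩, (localTensor_extChartAt hx ξ).symm⟩
  · rintro ⟨_, ⟨ξ, rfl⟩, rfl⟩
    exact ⟨ξ ∘L chartDiffSymm (𝓡 n) c x, (chartDiff_apply_tensor hx ξ).symm⟩

theorem finrank_range_localTensor (hx : x ∈ (extChartAt (𝓡 n) c).source) :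
    Module.finrank ℝ (localTensor (𝓡 n) c Θ (extChartAt (𝓡 n) c x) :
      (EuclideanSpace ℝ (Fin n) →L[ℝ] ℝ) →ₗ[ℝ] EuclideanSpace ℝ (Fin n)).range =
    Module.finrank ℝ (Θ.image x) := by
  rw [range_localTensor hx]
  exact (Submodule.equivMapOfInjective _ (chartDiff_injective hx) _).finrank_eq.symm

theorem coe_range_localTensor (hx : x ∈ (extChartAt (𝓡 n) c).source) :
    range (localTensor (𝓡 n) c Θ (extChartAt (𝓡 n) c x)) =
      chartDiff (𝓡 n) c x '' (Θ.image x : Set (TangentSpace (𝓡 n) x)) :=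
  congr(($(range_localTensor hx) : Set (EuclideanSpace ℝ (Fin n))))

theorem image_chartDiffSymm_range_localTensor (hx : x ∈ (extChartAt (𝓡 n) c).source) :
    chartDiffSymm (𝓡 n) c x '' range (localTensor (𝓡 n) c Θ (extChartAt (𝓡 n) c x)) =
      (Θ.image x : Set (TangentSpace (𝓡 n) x)) := by
  rw [coe_range_localTensor hx, image_image]
  simp only [chartDiffSymm_chartDiff hx, image_id']

theorem IsSymmetric.localTensor_comm (hΘ : Θ.IsSymmetric) (u : EuclideanSpace ℝ (Fin n))
    (ξ η : EuclideanSpace ℝ (Fin n) →L[ℝ] ℝ) :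
    η (localTensor (𝓡 n) c Θ u ξ) = ξ (localTensor (𝓡 n) c Θ u η) :=
  hΘ _ (ξ ∘L chartDiff (𝓡 n) c _) (η ∘L chartDiff (𝓡 n) c _)

theorem exists_isGeneralizedInverseOn_localTensor (hsmooth : Θ.IsSmooth) (hsymm : Θ.IsSymmetric)
    (hrank : Θ.HasConstantRank) (c : M) :
    ∃ G s, s ⊆ (extChartAt (𝓡 n) c).target ∧ extChartAt (𝓡 n) c c ∈ s ∧
      IsGeneralizedInverseOn (localTensor (𝓡 n) c Θ) G s := by
  obtain ⟨r, hr⟩ := hrank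
  refine exists_isGeneralizedInverseOn (r := r) (isOpen_extChartAt_target c)
    hsmooth.contDiffOn_localTensor (fun u _ ↦ hsymm.localTensor_comm u) (fun u hu ↦ ?_)
    (mem_extChartAt_target c)
  rw [← (extChartAt (𝓡 n) c).right_inv hu,
    finrank_range_localTensor ((extChartAt (𝓡 n) c).map_target hu), hr]

end Tensor20

end TensorCharts

section Brackets

open Set Topology VectorField

variable {E H M : Type*} [NormedAddCommGroup E] [NormedSpace ℝ E] [TopologicalSpace H]
  {I : ModelWithCorners ℝ E H} [I.Boundaryless] [TopologicalSpace M] [ChartedSpace H M]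
  [IsManifold I ∞ M] {c x : M}

theorem mpullback_extChartAt_symm {u : E} (hu : u ∈ (extChartAt I c).target)
    (Y : Π y : M, TangentSpace I y) :
    mpullback 𝓘(ℝ, E) I (extChartAt I c).symm Y u = localVec I c Y u := by
  have hx := (extChartAt I c).map_target hu
  have hinverse : (mfderiv 𝓘(ℝ, E) I (extChartAt I c).symm u).inverse =
      chartDiff I c ((extChartAt I c).symm u) :=
    (congrArg (ContinuousLinearMap.inverse (R := ℝ) (M := E))
      (hasMFDerivAt_extChartAt_symm hu).mfderiv).trans
      (ContinuousLinearMap.inverse_eq (ContinuousLinearMap.ext (chartDiffSymm_chartDiff hx))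
        (ContinuousLinearMap.ext (chartDiff_chartDiffSymm hx)))
  exact congr($(hinverse) _)

theorem chartDiff_mlieBracket [CompleteSpace E] (hx : x ∈ (extChartAt I c).source)
    {X Y : Π y : M, TangentSpace I y} (hX : MDiffAt (T% X) x) (hY : MDiffAt (T% Y) x) :
    chartDiff I c x (mlieBracket I X Y x) =
      lieBracket ℝ (localVec I c X) (localVec I c Y) (extChartAt I c x) := by
  have hu := (extChartAt I c).map_source hx
  have hinv := (extChartAt I c).left_inv hx
  have hT := extChartAt_target_mem_nhds' hu
  have hle (k : ℕ) : minSmoothness ℝ k ≤ ∞ :=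
    minSmoothness_of_isRCLikeNormedField.le.trans (WithTop.coe_le_coe.2 le_top)
  have : IsManifold I (minSmoothness ℝ 2) M := .of_le (hle 2)
  have : IsManifold I (minSmoothness ℝ 3) M := .of_le (hle 3)
  have hpullback := mpullback_mlieBracket (V := X) (W := Y) (x₀ := extChartAt I c x)
    (by rwa [hinv]) (by rwa [hinv]) ((contMDiffOn_extChartAt_symm c).contMDiffAt hT) (hle 2)
  rw [mpullback_extChartAt_symm hu, localVec_extChartAt hx] at hpullback
  have hlie : mlieBracket 𝓘(ℝ, E) (localVec I c X) (localVec I c Y) =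
      lieBracket ℝ (localVec I c X) (localVec I c Y) :=
    mlieBracketWithin_univ.symm.trans
      (mlieBracketWithin_eq_lieBracketWithin.trans lieBracketWithin_univ)
  rw [hpullback, ← hlie]
  exact Filter.EventuallyEq.mlieBracket_vectorField_eq
    (Filter.mem_of_superset hT fun u hu ↦ mpullback_extChartAt_symm hu X)
    (Filter.mem_of_superset hT fun u hu ↦ mpullback_extChartAt_symm hu Y)

section Tensor

variable {Θ : Π y : M, (TangentSpace I y →L[ℝ] ℝ) →L[ℝ] TangentSpace I y}

theorem mdifferentiableAt_tensor_comp_chartDiff (hx : x ∈ (extChartAt I c).source)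
    (hΘ : DifferentiableAt ℝ (localTensor I c Θ) (extChartAt I c x)) (ζ : E →L[ℝ] ℝ) :
    MDiffAt (T% fun y : M ↦ Θ y (ζ ∘L chartDiff I c y)) x :=
  (mdifferentiableAt_vectorField_iff hx).2 (hΘ.clm_apply (differentiableAt_const ζ))

theorem chartDiff_mlieBracket_tensor [CompleteSpace E] (hx : x ∈ (extChartAt I c).source)
    (hΘ : DifferentiableAt ℝ (localTensor I c Θ) (extChartAt I c x)) (ξ η : E →L[ℝ] ℝ) :
    chartDiff I c x (mlieBracket I (fun y ↦ Θ y (ξ ∘L chartDiff I c y))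
      (fun y ↦ Θ y (η ∘L chartDiff I c y)) x) =
    fderiv ℝ (localTensor I c Θ) (extChartAt I c x) (localTensor I c Θ (extChartAt I c x) ξ) η -
    fderiv ℝ (localTensor I c Θ) (extChartAt I c x) (localTensor I c Θ (extChartAt I c x) η) ξ := by
  have hfderiv (ζ : E →L[ℝ] ℝ) (v : E) :
      fderiv ℝ (localVec I c fun y ↦ Θ y (ζ ∘L chartDiff I c y)) (extChartAt I c x) v =
        fderiv ℝ (localTensor I c Θ) (extChartAt I c x) v ζ :=
    congr($((hΘ.hasFDerivAt.clm_apply (hasFDerivAt_const ζ _)).fderiv) v).trans (by simp)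
  rw [chartDiff_mlieBracket hx (mdifferentiableAt_tensor_comp_chartDiff hx hΘ ξ)
    (mdifferentiableAt_tensor_comp_chartDiff hx hΘ η), lieBracket, hfderiv, hfderiv]
  rfl

end Tensor

end Brackets

section IntegrableDistributions

open Set Topology

variable {n : ℕ} {M : Type*} [TopologicalSpace M] [ChartedSpace (EuclideanSpace ℝ (Fin n)) M]
  [IsManifold (𝓡 n) ∞ M] {c x : M} {Θ : Tensor20 n M}

namespace Tensor20

theorem IsParallel.isInvolutiveAt_localTensor {cov : Connection n M} (hpar : Θ.IsParallel cov)
    (htorsion : cov.torsion = 0) (hΘ : Θ.IsSmooth) (hx : x ∈ (extChartAt (𝓡 n) c).source) :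
    IsInvolutiveAt (localTensor (𝓡 n) c Θ) (extChartAt (𝓡 n) c x) := by
  intro ξ η
  have hd := hΘ.differentiableAt_localTensor hx
  have hcov (ζ : EuclideanSpace ℝ (Fin n) →L[ℝ] ℝ) (v : TangentSpace (𝓡 n) x) :
      cov (fun y ↦ Θ y (ζ ∘L chartDiff (𝓡 n) c y)) x v ∈ Θ.image x :=
    ⟨_, (hpar x _ (OneForm.differentiableAt_comp_chartDiff hx ζ) v).symm⟩
  rw [← chartDiff_mlieBracket_tensor hx hd, coe_range_localTensor hx,
    ← cov.torsion_eq_zero_iff.1 htorsion (mdifferentiableAt_tensor_comp_chartDiff hx hd ξ)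
      (mdifferentiableAt_tensor_comp_chartDiff hx hd η)]
  exact mem_image_of_mem _ (sub_mem (hcov η _) (hcov ξ _))

theorem IsIntegrable.isIntegrableDistribution_image (h : Θ.IsIntegrable) (hsmooth : Θ.IsSmooth)
    (hsymm : Θ.IsSymmetric) (hrank : Θ.HasConstantRank) : IsIntegrableDistribution Θ.image := by
  obtain ⟨cov, -, htorsion, hpar⟩ := h
  intro p
  obtain ⟨G, s, hst, hps, hG⟩ := exists_isGeneralizedInverseOn_localTensor hsmooth hsymm hrank p
  have hinv (u) (hu : u ∈ s) : IsInvolutiveAt (localTensor (𝓡 n) p Θ) u := by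
    rw [← (extChartAt (𝓡 n) p).right_inv (hst hu)]
    exact hpar.isInvolutiveAt_localTensor htorsion hsmooth
      ((extChartAt (𝓡 n) p).map_target (hst hu))
  obtain ⟨k, U, f, hU, hf, hfinj, hfs, ⟨a, ha, hfa⟩, hfder⟩ := hG.exists_integralManifold hinv hps
  have hft (b) (hb : b ∈ U) : f b ∈ (extChartAt (𝓡 n) p).target := hst (hfs hb)
  refine ⟨k, U, (extChartAt (𝓡 n) p).symm ∘ f, hU, ?_, ?_, ⟨a, ha, ?_⟩, fun b hb ↦ ?_⟩
  · exact (contMDiffOn_extChartAt_symm p).comp (contMDiffOn_iff_contDiffOn.2 hf) hft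
  · exact (extChartAt (𝓡 n) p).symm.injOn.comp hfinj hft
  · rw [Function.comp_apply, hfa, extChartAt_to_inv]
  · have hx := (extChartAt (𝓡 n) p).map_target (hft b hb)
    have hderiv := ((hasMFDerivAt_extChartAt_symm (hft b hb)).comp b
      (((hf.contDiffAt (hU.mem_nhds hb)).differentiableAt
        (by simp)).hasFDerivAt).hasMFDerivAt).mfderiv
    obtain ⟨hinj, hrange⟩ := hfder b hb
    rw [← (extChartAt (𝓡 n) p).right_inv (hft b hb)] at hrange
    rw [hderiv]
    refine ⟨(chartDiffSymm_injective hx).comp hinj, SetLike.coe_injective ?_⟩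
    exact (range_comp (chartDiffSymm (𝓡 n) p _) (fderiv ℝ f b)).trans (congr(_ '' $(hrange)).trans
      (image_chartDiffSymm_range_localTensor hx))

theorem isInvolutiveAt_localTensor_of_isIntegrableDistribution
    {G : EuclideanSpace ℝ (Fin n) → EuclideanSpace ℝ (Fin n) →L[ℝ] EuclideanSpace ℝ (Fin n) →L[ℝ] ℝ}
    {s : Set (EuclideanSpace ℝ (Fin n))} (h : IsIntegrableDistribution Θ.image)
    (hG : IsGeneralizedInverseOn (localTensor (𝓡 n) c Θ) G s)
    (hx : x ∈ (extChartAt (𝓡 n) c).source) (hxs : extChartAt (𝓡 n) c x ∈ s) :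
    IsInvolutiveAt (localTensor (𝓡 n) c Θ) (extChartAt (𝓡 n) c x) := by
  obtain ⟨k, U, f, hU, hf, -, ⟨a, ha, rfl⟩, hfder⟩ := h x
  have hfa := hf.contMDiffAt (hU.mem_nhds ha)
  have hchart : ContDiffAt ℝ ∞ (extChartAt (𝓡 n) c ∘ f) a :=
    contMDiffAt_iff_contDiffAt.1
      ((contMDiffAt_extChartAt' (by rwa [← extChartAt_source (𝓡 n)])).comp a hfa)
  refine hG.isInvolutiveAt_of_range_fderiv_eq (g := extChartAt (𝓡 n) c ∘ f)
    (hchart.of_le (WithTop.coe_le_coe.2 le_top)) hxs ?_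
  filter_upwards [hU.mem_nhds ha,
    hfa.continuousAt.preimage_mem_nhds (extChartAt_source_mem_nhds' hx)] with b hb hbs
  have hderiv := fderiv_extChartAt_comp hbs
    ((hf.contMDiffAt (hU.mem_nhds hb)).mdifferentiableAt (by simp))
  rw [funext hderiv, Function.comp_apply, coe_range_localTensor hbs, ← (hfder b hb).2]
  exact range_comp (chartDiff (𝓡 n) c (f b)) (mfderiv (𝓡 k) (𝓡 n) f b)

end Tensor20

end IntegrableDistributions

section LocalConnections

open Set Topology VectorField ContinuousLinearMap

variable {E H M : Type*} [NormedAddCommGroup E] [NormedSpace ℝ E] [TopologicalSpace H]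
  {I : ModelWithCorners ℝ E H} [TopologicalSpace M] [ChartedSpace H M] [IsManifold I ∞ M]
  {c x : M} {Γ : E → E →L[ℝ] E →L[ℝ] E}

/-- The differential operator `D` on vector fields has no torsion at `x`; this makes sense for an
operator that is a covariant derivative only near `x`. -/
def IsTorsionFreeAt (D : (Π y : M, TangentSpace I y) →
    Π y : M, TangentSpace I y →L[ℝ] TangentSpace I y) (x : M) : Prop :=
  ∀ ⦃X Y : Π y : M, TangentSpace I y⦄, MDiffAt (T% X) x → MDiffAt (T% Y) x →
    D Y x (X x) - D X x (Y x) = mlieBracket I X Y x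

variable (I c Γ) in
/-- The covariant derivative with Christoffel symbols `Γ` in the chart at `c`. -/
def localCov (Y : Π y : M, TangentSpace I y) (x : M) : TangentSpace I x →L[ℝ] TangentSpace I x :=
  chartDiffSymm I c x ∘L (fderiv ℝ (localVec I c Y) (extChartAt I c x) +
    (Γ (extChartAt I c x)).flip (localVec I c Y (extChartAt I c x))) ∘L chartDiff I c x

variable (I c Γ) in
/-- The covariant derivative of a `1`-form dual to `localCov I c Γ`. -/
def localDualCov (α : Π y : M, TangentSpace I y →L[ℝ] ℝ) (x : M) (v : TangentSpace I x) :
    TangentSpace I x →L[ℝ] ℝ :=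
  (fderiv ℝ (localForm I c α) (extChartAt I c x) (chartDiff I c x v) -
    localForm I c α (extChartAt I c x) ∘L Γ (extChartAt I c x) (chartDiff I c x v)) ∘L
    chartDiff I c x

theorem chartDiff_localCov (hx : x ∈ (extChartAt I c).source) (Y : Π y : M, TangentSpace I y)
    (v : TangentSpace I x) :
    chartDiff I c x (localCov I c Γ Y x v) =
      fderiv ℝ (localVec I c Y) (extChartAt I c x) (chartDiff I c x v) +
        Γ (extChartAt I c x) (chartDiff I c x v) (localVec I c Y (extChartAt I c x)) :=
  chartDiff_chartDiffSymm hx _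

section Boundaryless

variable [I.Boundaryless] {X Y : Π y : M, TangentSpace I y}

theorem localCov_add (hx : x ∈ (extChartAt I c).source) (hX : MDiffAt (T% X) x)
    (hY : MDiffAt (T% Y) x) :
    localCov I c Γ (X + Y) x = localCov I c Γ X x + localCov I c Γ Y x := by
  rw [mdifferentiableAt_vectorField_iff hx] at hX hY
  have hadd : localVec I c (X + Y) = localVec I c X + localVec I c Y :=
    funext fun u ↦ map_add (chartDiff I c _) _ _
  refine ContinuousLinearMap.ext fun v ↦ chartDiff_injective hx ?_
  refine Eq.trans ?_ (map_add (chartDiff I c x) (localCov I c Γ X x v)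
    (localCov I c Γ Y x v)).symm
  rw [chartDiff_localCov hx, chartDiff_localCov hx, chartDiff_localCov hx, hadd, fderiv_add hX hY]
  simp only [Pi.add_apply, map_add, _root_.add_apply]
  abel

theorem localCov_smul (hx : x ∈ (extChartAt I c).source) (hY : MDiffAt (T% Y) x) {g : M → ℝ}
    (hg : MDiffAt g x) :
    localCov I c Γ (g • Y) x = g x • localCov I c Γ Y x + (d% g x).smulRight (Y x) := by
  have hg' := (mdifferentiableAt_iff_comp_extChartAt_symm hx).1 hg
  rw [mdifferentiableAt_vectorField_iff hx] at hY
  have hsmul : localVec I c (g • Y) = fun u ↦ (g ∘ (extChartAt I c).symm) u • localVec I c Y u :=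
    funext fun u ↦ map_smul (chartDiff I c _) _ _
  refine ContinuousLinearMap.ext fun v ↦ chartDiff_injective hx ?_
  refine Eq.trans ?_ (map_add (chartDiff I c x) (g x • localCov I c Γ Y x v) (d% g x v • Y x)).symm
  rw [map_smul, map_smul, chartDiff_localCov hx, chartDiff_localCov hx, hsmul,
    fderiv_fun_smul hg' hY, mvfderiv_eq_fderiv_comp_extChartAt_symm hx hg,
    ← localVec_extChartAt hx Y]
  simp only [Function.comp_apply, (extChartAt I c).left_inv hx, map_smul, _root_.add_apply,
    _root_.smul_apply, ContinuousLinearMap.smulRight_apply, smul_add]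
  abel

theorem isCovariantDerivativeOn_localCov :
    IsCovariantDerivativeOn E (V := (TangentSpace I : M → Type _)) (localCov I c Γ)
      (extChartAt I c).source where
  add hX hY hx := localCov_add hx hX hY
  leibniz hY hg hx := localCov_smul hx hY hg

theorem localDualCov_apply (hx : x ∈ (extChartAt I c).source)
    {α : Π y : M, TangentSpace I y →L[ℝ] ℝ}
    (hα : DifferentiableAt ℝ (localForm I c α) (extChartAt I c x)) (hY : MDiffAt (T% Y) x)
    (v : TangentSpace I x) :
    localDualCov I c Γ α x v (Y x) = d% (fun y ↦ α y (Y y)) x v - α x (localCov I c Γ Y x v) := by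
  rw [mdifferentiableAt_vectorField_iff hx] at hY
  have hlocal : (fun y ↦ α y (Y y)) ∘ (extChartAt I c).symm =ᶠ[𝓝 (extChartAt I c x)]
      fun u ↦ localForm I c α u (localVec I c Y u) := by
    filter_upwards [extChartAt_target_mem_nhds' ((extChartAt I c).map_source hx)]
      with u hu using (localForm_localVec hu α Y).symm
  have hαY : MDiffAt (fun y ↦ α y (Y y)) x :=
    (mdifferentiableAt_iff_comp_extChartAt_symm hx).2
      ((hα.clm_apply hY).congr_of_eventuallyEq hlocal)
  have hcov : α x (localCov I c Γ Y x v) = localForm I c α (extChartAt I c x)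
      (chartDiff I c x (localCov I c Γ Y x v)) := by
    rw [localForm_extChartAt hx]
    exact congr(α x $(chartDiffSymm_chartDiff hx _)).symm
  rw [mvfderiv_eq_fderiv_comp_extChartAt_symm hx hαY, hlocal.fderiv_eq, fderiv_clm_apply hα hY,
    hcov, chartDiff_localCov hx, map_add, localVec_extChartAt hx Y]
  simp only [localDualCov, _root_.add_apply, _root_.sub_apply, ContinuousLinearMap.comp_apply,
    ContinuousLinearMap.flip_apply]
  abel

theorem localCov_tensor (hx : x ∈ (extChartAt I c).source)
    {Θ : Π y : M, (TangentSpace I y →L[ℝ] ℝ) →L[ℝ] TangentSpace I y}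
    (hΘ : DifferentiableAt ℝ (localTensor I c Θ) (extChartAt I c x))
    (hΓ : ∀ X ξ, fderiv ℝ (localTensor I c Θ) (extChartAt I c x) X ξ +
      Γ (extChartAt I c x) X (localTensor I c Θ (extChartAt I c x) ξ) +
      localTensor I c Θ (extChartAt I c x) (ξ ∘L Γ (extChartAt I c x) X) = 0)
    {α : Π y : M, TangentSpace I y →L[ℝ] ℝ}
    (hα : DifferentiableAt ℝ (localForm I c α) (extChartAt I c x)) (v : TangentSpace I x) :
    localCov I c Γ (fun y ↦ Θ y (α y)) x v = Θ x (localDualCov I c Γ α x v) := by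
  have hlocal : localVec I c (fun y ↦ Θ y (α y)) =ᶠ[𝓝 (extChartAt I c x)]
      fun u ↦ localTensor I c Θ u (localForm I c α u) := by
    filter_upwards [extChartAt_target_mem_nhds' ((extChartAt I c).map_source hx)]
      with u hu using (localTensor_localForm hu α).symm
  apply chartDiff_injective hx
  rw [chartDiff_localCov hx, hlocal.fderiv_eq, hlocal.eq_of_nhds, fderiv_clm_apply hΘ hα,
    localDualCov, ← localTensor_extChartAt hx, map_sub, sub_eq_add_neg,
    ← eq_neg_of_add_eq_zero_left (hΓ (chartDiff I c x v) (localForm I c α (extChartAt I c x)))]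
  simp only [_root_.add_apply, ContinuousLinearMap.comp_apply, ContinuousLinearMap.flip_apply]
  abel

theorem isTorsionFreeAt_localCov [CompleteSpace E] (hx : x ∈ (extChartAt I c).source)
    (hΓ : ∀ v w, Γ (extChartAt I c x) v w = Γ (extChartAt I c x) w v) :
    IsTorsionFreeAt (localCov I c Γ) x := by
  intro X Y hX hY
  apply chartDiff_injective hx
  rw [map_sub, chartDiff_mlieBracket hx hX hY, chartDiff_localCov hx, chartDiff_localCov hx,
    ← localVec_extChartAt hx X, ← localVec_extChartAt hx Y,
    hΓ (localVec I c X (extChartAt I c x)), lieBracket]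
  abel

end Boundaryless

theorem contMDiffCovariantDerivativeOn_localCov {s : Set E} (hs : IsOpen s)
    (hst : s ⊆ (extChartAt I c).target) (hΓ : ContDiffOn ℝ ∞ Γ s) :
    ContMDiffCovariantDerivativeOn E (V := (TangentSpace I : M → Type _)) ∞ (localCov I c Γ)
      ((extChartAt I c).source ∩ extChartAt I c ⁻¹' s) where
  contMDiff {Y} hY := by
    have hYs := contDiffOn_localVec hs hst (hY.of_le (by simp))
    have hflip : ContDiffOn ℝ ∞ (fun u ↦ (Γ u).flip) s :=
      (ContinuousLinearMap.flipₗᵢ ℝ E E E).contDiff.comp_contDiffOn hΓ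
    have hlocal : ContDiffOn ℝ ∞
        (fun u ↦ fderiv ℝ (localVec I c Y) u + (Γ u).flip (localVec I c Y u)) s :=
      (hYs.fderiv_of_isOpen hs (by simp)).add (hflip.clm_apply hYs)
    rw [Trivialization.contMDiffOn_section_iff (IB := I) (n := ∞)
      (trivializationAt (E →L[ℝ] E) (fun z : M ↦ TangentSpace I z →L[ℝ] TangentSpace I z) c)
      (isOpen_extChartAt_preimage' c hs) fun x hx ↦
        ⟨mem_baseSet_trivializationAt_iff.2 hx.1, mem_baseSet_trivializationAt_iff.2 hx.1⟩]
    refine ((contMDiffOn_iff_contDiffOn.2 hlocal).comp ((contMDiffOn_extChartAt (I := I)).mono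
      fun y hy ↦ by simpa only [extChartAt_source] using hy.1) fun y hy ↦ hy.2).congr fun y hy ↦ ?_
    ext1 w
    refine (chartDiff_localCov hy.1 Y (chartDiffSymm I c y w)).trans ?_
    rw [chartDiff_chartDiffSymm hy.1]
    rfl

end LocalConnections

section Averaging

open Set

variable {ι E H M : Type*} [NormedAddCommGroup E] [NormedSpace ℝ E]
  [TopologicalSpace H] {I : ModelWithCorners ℝ E H} [TopologicalSpace M] [ChartedSpace H M]

theorem mem_of_mem_finsupport {ρ : SmoothPartitionOfUnity ι I M univ} {U : ι → Set M}
    (hρ : ρ.IsSubordinate U) {i : ι} {x : M} (hi : i ∈ ρ.finsupport x) : x ∈ U i :=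
  hρ i (subset_tsupport _ ((ρ.mem_finsupport x).1 hi))

section VectorBundle

variable {F : Type*} [NormedAddCommGroup F] [NormedSpace ℝ F] {V : M → Type*}
  [TopologicalSpace (TotalSpace F V)] [∀ x, AddCommGroup (V x)] [∀ x, Module ℝ (V x)]
  [∀ x, TopologicalSpace (V x)] [∀ x, IsTopologicalAddGroup (V x)]
  [∀ x, ContinuousSMul ℝ (V x)] [FiberBundle F V]
  {ρ : SmoothPartitionOfUnity ι I M univ} {U : ι → Set M}
  {D : ι → (Π x : M, V x) → Π x : M, TangentSpace I x →L[ℝ] V x}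

variable (ρ D) in
/-- The average of the differential operators `D i` on sections of `V` with respect to a partition
of unity. -/
def averagedCov (σ : Π x : M, V x) (x : M) : TangentSpace I x →L[ℝ] V x :=
  ∑ᶠ i, ρ i x • D i σ x

theorem averagedCov_eq_sum (σ : Π x : M, V x) (x : M) :
    averagedCov ρ D σ x = ∑ i ∈ ρ.finsupport x, ρ i x • D i σ x :=
  (ρ.sum_finsupport_smul_eq_finsum x fun i _ ↦ D i σ x).symm

theorem averagedCov_apply (σ : Π x : M, V x) (x : M) (v : TangentSpace I x) :
    averagedCov ρ D σ x v = ∑ i ∈ ρ.finsupport x, ρ i x • D i σ x v :=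
  congr($(averagedCov_eq_sum σ x) v).trans (_root_.sum_apply _ _ _)

theorem isCovariantDerivativeOn_averagedCov (hρ : ρ.IsSubordinate U)
    (hD : ∀ i, IsCovariantDerivativeOn F (D i) (U i)) :
    IsCovariantDerivativeOn F (averagedCov ρ D) univ where
  add {σ τ x} hσ hτ _ := by
    simp only [averagedCov_eq_sum, ← Finset.sum_add_distrib]
    refine Finset.sum_congr rfl fun i hi ↦ ?_
    rw [(hD i).add hσ hτ (mem_of_mem_finsupport hρ hi), smul_add]
  leibniz {σ g x} hσ hg _ := by
    have hone : (d% g x).smulRight (σ x) =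
        ∑ i ∈ ρ.finsupport x, ρ i x • (d% g x).smulRight (σ x) := by
      rw [← Finset.sum_smul, ρ.sum_finsupport x (mem_univ x), one_smul]
    rw [hone, averagedCov_eq_sum, averagedCov_eq_sum, Finset.smul_sum, ← Finset.sum_add_distrib]
    refine Finset.sum_congr rfl fun i hi ↦ ?_
    rw [(hD i).leibniz hσ hg (mem_of_mem_finsupport hρ hi), smul_add, smul_comm]

theorem contMDiffCovariantDerivativeOn_averagedCov [IsManifold I ∞ M] [VectorBundle ℝ F V]
    (hρ : ρ.IsSubordinate U) (hU : ∀ i, IsOpen (U i))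
    (hD : ∀ i, ContMDiffCovariantDerivativeOn F ∞ (D i) (U i)) :
    ContMDiffCovariantDerivativeOn F ∞ (averagedCov ρ D) univ where
  contMDiff {σ} hσ := by
    refine (ContMDiff.finsum_section_of_locallyFinite
      (V := fun z : M ↦ TangentSpace I z →L[ℝ] V z) (t := fun i y ↦ ρ i y • D i σ y)
      (ρ.locallyFinite.subset fun i x hx ↦ left_ne_zero_of_smul hx) fun i ↦ ?_).contMDiffOn
    exact ContMDiffOn.smul_section_of_tsupport (V := fun z : M ↦ TangentSpace I z →L[ℝ] V z)
      (ρ i).contMDiff.contMDiffOn (hU i) (hρ i) ((hD i).contMDiff (hσ.mono (subset_univ _)))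

end VectorBundle

theorem isTorsionFreeAt_averagedCov [IsManifold I ∞ M] {ρ : SmoothPartitionOfUnity ι I M univ}
    {D : ι → (Π y : M, TangentSpace I y) → Π y : M, TangentSpace I y →L[ℝ] TangentSpace I y} {x : M}
    (hD : ∀ i ∈ ρ.finsupport x, IsTorsionFreeAt (D i) x) :
    IsTorsionFreeAt (averagedCov ρ D) x := by
  intro X Y hX hY
  rw [averagedCov_apply, averagedCov_apply, ← Finset.sum_sub_distrib]
  have hbracket (i) (hi : i ∈ ρ.finsupport x) : ρ i x • D i Y x (X x) - ρ i x • D i X x (Y x) =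
      ρ i x • VectorField.mlieBracket I X Y x := by
    rw [← smul_sub, hD i hi hX hY]
  rw [Finset.sum_congr rfl hbracket, ← Finset.sum_smul, ρ.sum_finsupport x (mem_univ x), one_smul]

end Averaging

section Existence

open Set

variable {n : ℕ} {M : Type*} [TopologicalSpace M] [ChartedSpace (EuclideanSpace ℝ (Fin n)) M]
  [IsManifold (𝓡 n) ∞ M] {Θ : Tensor20 n M}

namespace Tensor20

/-- `∇Θ = 0` at `x` for a differential operator `∇ = D` on vector fields that is a covariant
derivative only near `x`; the form `β` is `∇_v α`. -/
def IsParallelAt (Θ : Tensor20 n M) (D : (Π y : M, TangentSpace (𝓡 n) y) →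
    Π y : M, TangentSpace (𝓡 n) y →L[ℝ] TangentSpace (𝓡 n) y) (x : M) : Prop :=
  ∀ ⦃α : OneForm n M⦄, α.DifferentiableAt x → ∀ v : TangentSpace (𝓡 n) x,
    ∃ β : TangentSpace (𝓡 n) x →L[ℝ] ℝ,
      (∀ ⦃Y : Π y : M, TangentSpace (𝓡 n) y⦄,
        MDifferentiableAt (𝓡 n) ((𝓡 n).prod 𝓘(ℝ, EuclideanSpace ℝ (Fin n)))
          (fun y ↦ TotalSpace.mk' (EuclideanSpace ℝ (Fin n)) y (Y y)) x →
        β (Y x) = mvfderiv (𝓡 n) (fun y ↦ α y (Y y)) x v - α x (D Y x v)) ∧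
      D (fun y ↦ Θ y (α y)) x v = Θ x β

theorem isParallel_of_isParallelAt {cov : Connection n M} (h : ∀ x, Θ.IsParallelAt cov x) :
    Θ.IsParallel cov := by
  intro x α hα v
  obtain ⟨β, hβ, hcov⟩ := h x hα v
  rw [hcov]
  congr 1
  ext w
  have hw := FiberBundle.mdifferentiableAt_extend (𝓡 n) (EuclideanSpace ℝ (Fin n)) w
  rw [← FiberBundle.extend_apply_self (EuclideanSpace ℝ (Fin n)) w, hβ hw,
    dualDeriv_apply cov hα hw]

theorem IsParallelAt.averagedCov {ι : Type*} {ρ : SmoothPartitionOfUnity ι (𝓡 n) M univ}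
    {D : ι → (Π y : M, TangentSpace (𝓡 n) y) →
      Π y : M, TangentSpace (𝓡 n) y →L[ℝ] TangentSpace (𝓡 n) y} {x : M}
    (hD : ∀ i ∈ ρ.finsupport x, Θ.IsParallelAt (D i) x) :
    Θ.IsParallelAt (averagedCov ρ D) x := by
  intro α hα v
  choose! β hβ hΘ using fun i hi ↦ hD i hi hα v
  refine ⟨∑ i ∈ ρ.finsupport x, ρ i x • β i, fun Y hY ↦ ?_, ?_⟩
  · have hone : mvfderiv (𝓡 n) (fun y ↦ α y (Y y)) x v =
        ∑ i ∈ ρ.finsupport x, ρ i x • mvfderiv (𝓡 n) (fun y ↦ α y (Y y)) x v := by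
      rw [← Finset.sum_smul, ρ.sum_finsupport x (mem_univ x), one_smul]
    rw [hone, averagedCov_apply, map_sum, ← Finset.sum_sub_distrib]
    refine (_root_.sum_apply _ _ _).trans (Finset.sum_congr rfl fun i hi ↦ ?_)
    rw [map_smul, ← smul_sub, ← hβ i hi hY]
    rfl
  · rw [averagedCov_apply, map_sum]
    refine Finset.sum_congr rfl fun i hi ↦ ?_
    rw [map_smul, hΘ i hi]

theorem isParallelAt_localCov (hΘ : Θ.IsSmooth) {c x : M} (hx : x ∈ (extChartAt (𝓡 n) c).source)
    {Γ : EuclideanSpace ℝ (Fin n) →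
      EuclideanSpace ℝ (Fin n) →L[ℝ] EuclideanSpace ℝ (Fin n) →L[ℝ] EuclideanSpace ℝ (Fin n)}
    (hΓ : ∀ X ξ, fderiv ℝ (localTensor (𝓡 n) c Θ) (extChartAt (𝓡 n) c x) X ξ +
      Γ (extChartAt (𝓡 n) c x) X (localTensor (𝓡 n) c Θ (extChartAt (𝓡 n) c x) ξ) +
      localTensor (𝓡 n) c Θ (extChartAt (𝓡 n) c x) (ξ ∘L Γ (extChartAt (𝓡 n) c x) X) = 0) :
    Θ.IsParallelAt (localCov (𝓡 n) c Γ) x := fun α hα v ↦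
  have hα' := (OneForm.differentiableAt_iff hx).1 hα
  ⟨localDualCov (𝓡 n) c Γ α x v, fun _ hY ↦ localDualCov_apply hx hα' hY v,
    localCov_tensor hx (hΘ.differentiableAt_localTensor hx) hΓ hα' v⟩

theorem isIntegrable_of_isIntegrableDistribution_image [T2Space M] [SecondCountableTopology M]
    (hsmooth : Θ.IsSmooth) (hsymm : Θ.IsSymmetric) (hrank : Θ.HasConstantRank)
    (h : IsIntegrableDistribution Θ.image) : Θ.IsIntegrable := by
  choose G s hst hs hG using exists_isGeneralizedInverseOn_localTensor hsmooth hsymm hrank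
  let U (c : M) : Set M := (extChartAt (𝓡 n) c).source ∩ extChartAt (𝓡 n) c ⁻¹' s c
  have hU (c : M) : IsOpen (U c) := isOpen_extChartAt_preimage' c (hG c).isOpen
  have hinv {c x : M} (hx : x ∈ U c) :
      IsInvolutiveAt (localTensor (𝓡 n) c Θ) (extChartAt (𝓡 n) c x) :=
    isInvolutiveAt_localTensor_of_isIntegrableDistribution h (hG c) hx.1 hx.2
  have : LocallyCompactSpace M := ChartedSpace.locallyCompactSpace (EuclideanSpace ℝ (Fin n)) M
  obtain ⟨ρ, hρ⟩ := SmoothPartitionOfUnity.exists_isSubordinate (𝓡 n) isClosed_univ U hU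
    fun x _ ↦ mem_iUnion.2 ⟨x, mem_extChartAt_source x, hs x⟩
  let D (c : M) := localCov (𝓡 n) c (christoffel (localTensor (𝓡 n) c Θ) (G c))
  have hD (c : M) : IsCovariantDerivativeOn (EuclideanSpace ℝ (Fin n)) (D c) (U c) :=
    isCovariantDerivativeOn_localCov.mono inter_subset_left
  let cov : Connection n M := ⟨averagedCov ρ D, isCovariantDerivativeOn_averagedCov hρ hD⟩
  refine ⟨cov, ⟨contMDiffCovariantDerivativeOn_averagedCov hρ hU fun c ↦
    contMDiffCovariantDerivativeOn_localCov (hG c).isOpen (hst c) (hG c).contDiffOn_christoffel⟩,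
    cov.torsion_eq_zero_iff.2 fun {X Y x} hX hY ↦
      isTorsionFreeAt_averagedCov (fun c hc ↦ ?_) hX hY,
    isParallel_of_isParallelAt fun x ↦ IsParallelAt.averagedCov fun c hc ↦ ?_⟩
  · have hx := mem_of_mem_finsupport hρ hc
    exact isTorsionFreeAt_localCov hx.1 ((hG c).christoffel_comm hx.2 (hinv hx))
  · have hx := mem_of_mem_finsupport hρ hc
    exact isParallelAt_localCov hsmooth hx.1 ((hG c).christoffel_parallel hx.2 (hinv hx))

end Tensor20

end Existence

end

end SymTensor

theorem propositionE (n : ℕ) (M : Type*) [TopologicalSpace M] [T2Space M]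
    [SecondCountableTopology M] [ChartedSpace (EuclideanSpace ℝ (Fin n)) M]
    [IsManifold (𝓡 n) ∞ M] (Θ : SymTensor.Tensor20 n M) (hsmooth : Θ.IsSmooth)
    (hsymm : Θ.IsSymmetric) (hrank : Θ.HasConstantRank) :
    Θ.IsIntegrable ↔ SymTensor.IsIntegrableDistribution Θ.image :=
  ⟨fun h ↦ h.isIntegrableDistribution_image hsmooth hsymm hrank,
    SymTensor.Tensor20.isIntegrable_of_isIntegrableDistribution_image hsmooth hsymm hrank⟩
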